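/- Let $K$ be a commutative ring with identity and $G$ a group. Let $\mathcal{S}(G)$ be Exel's semigroup, i.e. the monoid generated by symbols $[t]$, $t\in G$, with relations $[1]=1$, $[s^{-1}][s][t]=[s^{-1}][st]$ and $[s][t][t^{-1}]=[st][t^{-1}]$; let $K_{\mathrm{par}}G$ be its semigroup $K$-algebra and put $e_t=[t][t^{-1}]$. Let $\mathcal{B}\subseteq K_{\mathrm{par}}G$ be the commutative subalgebra generated by the idempotents of $\mathcal{S}(G)$, regarded as a right $K_{\mathrm{par}}G$-module via $u\triangleleft[g]=[g^{-1}]\,u\,[g]$. For a left $K_{\mathrm{par}}G$-module $X$, the partial group homology is $H^{\mathrm{par}}_n(G,X)=\operatorname{Tor}_n^{K_{\mathrm{par}}G}(\mathcal{B},X)$, and the globalization of $X$ is the $KG$-module $\Lambda(X)=(KG\otimes_K X)/\mathcal{K}$, where $\mathcal{K}$ is the $K$-submodule generated by all $s\otimes[h]x-sh\otimes e_{h^{-1}}x$ ($s,h\in G$, $x\in X$); write $\lfloor s,x\rfloor$ for the class of $s\otimes x$, so that $h\cdot\lfloor s,x\rfloor=\lfloor hs,x\rfloor$. **Proposition.**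 Let $X$ be a left $K_{\mathrm{par}}G$-module with a $G$-grading $X=\bigoplus_{t\in G}X_t$ by $K$-submodules such that $[h]X_t\subseteq X_{hth^{-1}}$ for all $h,t\in G$. Let $g\in G$, let $\overline{g}$ be its conjugacy class and $\mathcal{C}_g$ its centralizer in $G$. Let $X_{\overline g}=\bigoplus_{t\in\overline g}X_t$, a $K_{\mathrm{par}}G$-submodule of $X$, and let $\Lambda(X_{\overline g})_g$ be the $K$-submodule of $\Lambda(X_{\overline g})$ generated by all $\lfloor h,x\rfloor$ with $h\in G$, $x\in X_t$, $t\in\overline g$ and $hth^{-1}=g$; it is stable under $\mathcal{C}_g$. Then, for all $n\ge 0$, there is an isomorphism of $K$-modules $$H^{\mathrm{par}}_n(G,X_{\overline g})\;\cong\;H_n(\mathcal{C}_g,\Lambda(X_{\overline g})_g),$$ where the right-hand side is ordinary group homology. If moreover, for every $t\in\overline g$, $$X_t=\sum_{h\in G,\;hgh^{-1}=t}[h]\cdot X_g,$$ then, for all $n\ge 0$, there is an isomorphism of $K$-modules $$H^{\mathrm{par}}_n(G,X_{\overline g})\;\cong\;H^{\mathrm{par}}_n(\mathcal{C}_g,X_g),$$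 where $X_g$ is a $K_{\mathrm{par}}\mathcal{C}_g$-module with each generator $[c]$, $c\in\mathcal{C}_g$, acting as on $X$. -/

import Mathlib

open scoped TensorProduct
open CategoryTheory

universe u

noncomputable section

namespace PartialHomology

/-! ### Exel's semigroup and the partial group algebra -/

section Exel

variable (G : Type u) [Group G]

/-- The defining relations of Exel's semigroup on the symbols `[t]`, `t ∈ G`. -/
inductive ExelRel : FreeMonoid G → FreeMonoid G → Prop
  | one : ExelRel (FreeMonoid.of 1) 1
  | left (s t : G) :
      ExelRel (FreeMonoid.of s⁻¹ * FreeMonoid.of s * FreeMonoid.of t)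
        (FreeMonoid.of s⁻¹ * FreeMonoid.of (s * t))
  | right (s t : G) :
      ExelRel (FreeMonoid.of s * FreeMonoid.of t * FreeMonoid.of t⁻¹)
        (FreeMonoid.of (s * t) * FreeMonoid.of t⁻¹)

/-- Exel's semigroup `S(G)`. -/
abbrev Exel : Type u := PresentedMonoid (ExelRel G)

variable {G}

namespace Exel

/-- The generator `[t]` of `S(G)`. -/
def br (t : G) : Exel G := PresentedMonoid.of (ExelRel G) t

/-- The idempotent `e_t = [t][t⁻¹]` of `S(G)`. -/
def e (t : G) : Exel G := br t * br t⁻¹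

theorem br_one : br (1 : G) = 1 :=
  PresentedMonoid.mk_eq_mk_of_rel (ExelRel.one (G := G))

theorem br_left (s t : G) : br s⁻¹ * br s * br t = br s⁻¹ * br (s * t) :=
  PresentedMonoid.mk_eq_mk_of_rel (ExelRel.left s t)

theorem br_right (s t : G) : br s * br t * br t⁻¹ = br (s * t) * br t⁻¹ :=
  PresentedMonoid.mk_eq_mk_of_rel (ExelRel.right s t)

/-- Maps out of `S(G)`: a map `f` from `G` to a monoid satisfying the defining relations
of a partial representation extends to `S(G)`. -/
def lift {M : Type*} [Monoid M] (f : G → M) (h1 : f 1 = 1)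
    (h2 : ∀ s t, f s⁻¹ * f s * f t = f s⁻¹ * f (s * t))
    (h3 : ∀ s t, f s * f t * f t⁻¹ = f (s * t) * f t⁻¹) : Exel G →* M :=
  PresentedMonoid.lift f (by
    rintro a b (_ | ⟨s, t⟩ | ⟨s, t⟩)
    · simpa using h1
    · simpa using h2 s t
    · simpa using h3 s t)

@[simp] theorem lift_br {M : Type*} [Monoid M] (f : G → M) (h1 h2 h3) (t : G) :
    lift f h1 h2 h3 (br t) = f t := rfl

/-- The inversion `w ↦ w*` of `S(G)`: the anti-automorphism with `[t]* = [t⁻¹]`. -/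
def inv : Exel G →* (Exel G)ᵐᵒᵖ :=
  lift (fun t => MulOpposite.op (br t⁻¹)) (by simp [br_one])
    (fun s t => by
      simp only [← MulOpposite.op_mul, inv_inv]
      have h := br_right t⁻¹ s⁻¹
      rw [inv_inv] at h
      rw [mul_inv_rev, ← h, mul_assoc])
    (fun s t => by
      simp only [← MulOpposite.op_mul, inv_inv]
      rw [mul_inv_rev, ← mul_assoc]
      congr 1
      simpa using br_left t⁻¹ s⁻¹)

theorem induction {p : Exel G → Prop} (one : p 1) (mul : ∀ t w, p w → p (br t * w))
    (w : Exel G) : p w := by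
  have hw : w ∈ Submonoid.closure (Set.range (PresentedMonoid.of (ExelRel G))) := by simp
  induction hw using Submonoid.closure_induction_left with
  | one => exact one
  | mul_left x hx y _ ih => obtain ⟨t, rfl⟩ := hx; exact mul t y ih

theorem br_inv_br (t : G) : br t * br t⁻¹ * br t = br t := by
  have := br_right t t⁻¹
  simpa [br_one] using this

theorem br_mul_e (g h : G) : br g * e h = e (g * h) * br g := by
  have h1 := br_left (g * h)⁻¹ g
  simp only [inv_inv, mul_inv_rev, mul_assoc, inv_mul_cancel, mul_one] at h1
  have h2 := br_right g h
  simp only [e, mul_inv_rev, mul_assoc] at h2 ⊢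
  rw [h2, h1]

theorem e_comm (g h : G) : e g * e h = e h * e g := by
  have h1 := br_mul_e g⁻¹ h
  have h2 := br_mul_e g (g⁻¹ * h)
  rw [mul_inv_cancel_left] at h2
  calc e g * e h = br g * (br g⁻¹ * e h) := by simp only [e, mul_assoc]
    _ = (br g * e (g⁻¹ * h)) * br g⁻¹ := by rw [h1, mul_assoc]
    _ = e h * e g := by rw [h2]; simp only [e, mul_assoc]

theorem e_idem (g : G) : e g * e g = e g := by
  rw [e, ← mul_assoc, br_inv_br]

/-- The submonoid generated by the `e_t`. -/
def E (G : Type u) [Group G] : Submonoid (Exel G) := Submonoid.closure (Set.range e)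

theorem E_comm {x y : Exel G} (hx : x ∈ E G) (hy : y ∈ E G) : x * y = y * x := by
  refine Submonoid.closure_induction₂ (motive := fun a b _ _ => a * b = b * a)
    ?_ ?_ ?_ ?_ ?_ hx hy
  · rintro _ _ ⟨g, rfl⟩ ⟨h, rfl⟩; exact e_comm g h
  · simp
  · simp
  · intro x y z _ _ _ h1 h2; exact Commute.mul_left h1 h2
  · intro x y z _ _ _ h1 h2; exact Commute.mul_right h1 h2

theorem E_idem {x : Exel G} (hx : x ∈ E G) : IsIdempotentElem x := by
  induction hx using Submonoid.closure_induction with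
  | mem x hx => obtain ⟨g, rfl⟩ := hx; exact e_idem g
  | one => exact mul_one _
  | mul x y hx hy ihx ihy => exact IsIdempotentElem.mul_of_commute (E_comm hx hy) ihx ihy

theorem br_mul_E (t : G) {c : Exel G} (hc : c ∈ E G) : ∃ d ∈ E G, br t * c = d * br t := by
  induction hc using Submonoid.closure_induction with
  | mem x hx =>
    obtain ⟨g, rfl⟩ := hx
    exact ⟨_, Submonoid.subset_closure ⟨_, rfl⟩, br_mul_e t g⟩
  | one => exact ⟨1, one_mem _, by simp⟩
  | mul x y _ _ ihx ihy =>
    obtain ⟨d, hd, h1⟩ := ihx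
    obtain ⟨d', hd', h2⟩ := ihy
    exact ⟨d * d', mul_mem hd hd', by rw [← mul_assoc, h1, mul_assoc, h2, mul_assoc]⟩

theorem normal_form (w : Exel G) : ∃ c ∈ E G, ∃ g : G, w = c * br g := by
  induction w using induction with
  | one => exact ⟨1, one_mem _, 1, by simp [br_one]⟩
  | mul t w ih =>
    obtain ⟨c, hc, g, rfl⟩ := ih
    obtain ⟨d, hd, h⟩ := br_mul_E t hc
    refine ⟨d * e t, mul_mem hd (Submonoid.subset_closure ⟨_, rfl⟩), t * g, ?_⟩
    have h1 := br_left t⁻¹ (t * g)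
    rw [inv_inv, inv_mul_cancel_left] at h1
    rw [← mul_assoc, h, mul_assoc, mul_assoc]
    congr 1
    rw [e, h1]

/-- The degree map `S(G) → G`, `[t] ↦ t`. -/
def deg : Exel G →* G := lift id rfl (by simp) (by simp)

theorem deg_E {c : Exel G} (hc : c ∈ E G) : deg c = 1 := by
  have h := E_idem hc
  have : deg c * deg c = deg c := by rw [← map_mul, h]
  simpa using this

theorem mem_E_iff {w : Exel G} : w ∈ E G ↔ IsIdempotentElem w := by
  refine ⟨E_idem, fun h => ?_⟩
  obtain ⟨c, hc, g, rfl⟩ := normal_form w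
  have h1 : deg (c * br g) * deg (c * br g) = deg (c * br g) := by rw [← map_mul, h]
  have h2 : deg (c * br g) = g := by rw [map_mul, deg_E hc, one_mul]; rfl
  rw [h2] at h1
  obtain rfl : g = 1 := by simpa using h1
  rwa [br_one, mul_one]

theorem inv_mul_E_mul (w : Exel G) {s : Exel G} (hs : s ∈ E G) :
    (inv w).unop * s * w ∈ E G := by
  induction w using induction generalizing s with
  | one => simpa using hs
  | mul t w ih =>
    have h : (inv (br t * w)).unop = (inv w).unop * br t⁻¹ := by rw [map_mul]; rfl
    obtain ⟨d, hd, h1⟩ := br_mul_E t⁻¹ hs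
    have h2 : br t⁻¹ * s * br t ∈ E G := by
      rw [h1, mul_assoc]
      exact mul_mem hd (Submonoid.subset_closure ⟨t⁻¹, by simp [e]⟩)
    rw [h]
    simpa only [mul_assoc] using ih h2

end Exel

end Exel

section PartialGroupAlgebra

variable (K G : Type u) [CommRing K] [Group G]

/-- The partial group algebra `K_par G`: the semigroup algebra of Exel's semigroup. -/
abbrev KPar : Type u := MonoidAlgebra K (Exel G)

variable {G}

/-- The generator `[t]` of `K_par G`. -/
def br (t : G) : KPar K G := MonoidAlgebra.of K (Exel G) (Exel.br t)

/-- The idempotent `e_t = [t][t⁻¹]` of `K_par G`. -/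
def idem (t : G) : KPar K G := br K t * br K t⁻¹

variable (G)

/-- The commutative subalgebra of `K_par G` generated by the idempotents of `S(G)`. -/
def idemAlgebra : Subalgebra K (KPar K G) :=
  Algebra.adjoin K (MonoidAlgebra.of K (Exel G) '' {w | IsIdempotentElem w})

theorem idemAlgebra_eq_span :
    Subalgebra.toSubmodule (idemAlgebra K G) =
      Submodule.span K (MonoidAlgebra.of K (Exel G) '' {w | IsIdempotentElem w}) := by
  have h : MonoidAlgebra.of K (Exel G) '' {w | IsIdempotentElem w} =
      ((Exel.E G).map (MonoidAlgebra.of K (Exel G)) : Set (KPar K G)) := by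
    ext x; simp [← Exel.mem_E_iff]
  rw [idemAlgebra, Algebra.adjoin_eq_span, h, Submonoid.closure_eq]

variable {G} in
/-- For `w ∈ S(G)`, the operator `u ↦ w* u w` on the subalgebra generated by the idempotents. -/
def idemAct (w : Exel G) : Module.End K (idemAlgebra K G) :=
  ((LinearMap.mulLeft K (MonoidAlgebra.of K (Exel G) (Exel.inv w).unop)) ∘ₗ
    (LinearMap.mulRight K (MonoidAlgebra.of K (Exel G) w))).restrict
      (p := Subalgebra.toSubmodule (idemAlgebra K G))
      (q := Subalgebra.toSubmodule (idemAlgebra K G)) (by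
    intro x hx
    rw [idemAlgebra_eq_span] at hx ⊢
    induction hx using Submodule.span_induction with
    | mem x hx =>
      obtain ⟨s, hs, rfl⟩ := hx
      refine Submodule.subset_span
        ⟨_, Exel.mem_E_iff.1 (Exel.inv_mul_E_mul w (Exel.mem_E_iff.2 hs)), ?_⟩
      simp only [map_mul, LinearMap.comp_apply, LinearMap.mulLeft_apply,
        LinearMap.mulRight_apply, mul_assoc]
    | zero => simp
    | add x y _ _ hx hy => rw [map_add]; exact add_mem hx hy
    | smul a x _ hx => rw [map_smul]; exact Submodule.smul_mem _ _ hx)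

variable {G} in
theorem idemAct_coe (w : Exel G) (u : idemAlgebra K G) :
    (idemAct K w u : KPar K G) =
      MonoidAlgebra.of K (Exel G) (Exel.inv w).unop * (u * MonoidAlgebra.of K (Exel G) w) := rfl

/-- The right action of `K_par G` on the subalgebra generated by the idempotents, with
`u ◁ w = w* u w` for `w ∈ S(G)`; in particular `u ◁ [g] = [g⁻¹] u [g]`. -/
def idemRightAction : KPar K G →ₐ[K] (Module.End K (idemAlgebra K G))ᵐᵒᵖ :=
  MonoidAlgebra.lift K _ (Exel G)
    { toFun := fun w => MulOpposite.op (idemAct K w)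
      map_one' := by
        congr 1
        ext u : 2
        simp [idemAct_coe, ← MonoidAlgebra.one_def]
      map_mul' := fun v w => by
        rw [← MulOpposite.op_mul]
        congr 1
        ext u : 2
        simp only [Module.End.mul_apply, idemAct_coe, map_mul, MulOpposite.unop_mul, mul_assoc] }

/-- The right `K_par G`-module `𝓑`: the commutative subalgebra of `K_par G` generated by the
idempotents of `S(G)`, with `u ◁ [g] = [g⁻¹] u [g]`. -/
def Idem : Type u := ↥(idemAlgebra K G)

instance : AddCommGroup (Idem K G) := inferInstanceAs (AddCommGroup ↥(idemAlgebra K G))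

instance : Module K (Idem K G) := inferInstanceAs (Module K ↥(idemAlgebra K G))

instance : Module (KPar K G)ᵐᵒᵖ (Idem K G) where
  smul z u := (idemRightAction K G z.unop).unop u
  one_smul u := by
    change (idemRightAction K G 1).unop u = u
    rw [map_one]; rfl
  mul_smul z w u := by
    change (idemRightAction K G (w.unop * z.unop)).unop u =
      (idemRightAction K G z.unop).unop ((idemRightAction K G w.unop).unop u)
    rw [map_mul]; rfl
  smul_zero z := map_zero (idemRightAction K G z.unop).unop
  smul_add z := map_add (idemRightAction K G z.unop).unop
  add_smul z w u := by
    change (idemRightAction K G (z.unop + w.unop)).unop u = _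
    rw [map_add]; rfl
  zero_smul u := by
    change (idemRightAction K G 0).unop u = 0
    rw [map_zero]; rfl

theorem idem_smul_br (g : G) (u : Idem K G) :
    ((show idemAlgebra K G from MulOpposite.op (br K g) • u) : KPar K G) =
      br K g⁻¹ * (show idemAlgebra K G from u : KPar K G) * br K g := by
  change ((idemRightAction K G (br K g)).unop u : KPar K G) = _
  rw [PartialHomology.br, idemRightAction, MonoidAlgebra.lift_of, mul_assoc]
  rfl

end PartialGroupAlgebra

/-! ### `Tor` over a noncommutative algebra -/

section Tor

variable (K R : Type u) [CommRing K] [Ring R] (N : Type u) [AddCommGroup N] [Module K N]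
  [Module Rᵐᵒᵖ N]

/-- The `K`-submodule of `N ⊗_ℤ M` generated by the elements `n r ⊗ m - n ⊗ r m`;
here `K` acts through `N`. -/
def balancedRel (M : Type u) [AddCommGroup M] [Module R M] : Submodule K (N ⊗[ℤ] M) :=
  Submodule.span K {z | ∃ (n : N) (r : R) (m : M),
    z = (MulOpposite.op r • n) ⊗ₜ[ℤ] m - n ⊗ₜ[ℤ] (r • m)}

/-- The balanced tensor product `N ⊗_R M`, as a `K`-module. -/
abbrev BalancedTensor (M : Type u) [AddCommGroup M] [Module R M] : Type u :=
  (N ⊗[ℤ] M) ⧸ balancedRel K R N M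

variable {R}

/-- The class of `n ⊗ m` in `N ⊗_R M`. -/
def balancedMk {M : Type u} [AddCommGroup M] [Module R M] (n : N) (m : M) :
    BalancedTensor K R N M :=
  Submodule.Quotient.mk (n ⊗ₜ[ℤ] m)

/-- The map `N ⊗_R f`. -/
def balancedMap {M M' : Type u} [AddCommGroup M] [Module R M] [AddCommGroup M'] [Module R M']
    (f : M →ₗ[R] M') : BalancedTensor K R N M →ₗ[K] BalancedTensor K R N M' :=
  Submodule.mapQ _ _
    (TensorProduct.AlgebraTensorModule.lTensor K N f.toAddMonoidHom.toIntLinearMap) (by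
      rw [balancedRel, Submodule.span_le]
      rintro _ ⟨n, r, m, rfl⟩
      refine Submodule.subset_span ⟨n, r, f m, ?_⟩
      simp)

variable {K N} in
theorem balanced_ext {M : Type u} [AddCommGroup M] [Module R M] {V : Type u} [AddCommGroup V]
    [Module K V] {f g : BalancedTensor K R N M →ₗ[K] V}
    (h : ∀ n m, f (balancedMk K N n m) = g (balancedMk K N n m)) : f = g := by
  refine LinearMap.ext fun x => ?_
  obtain ⟨x, rfl⟩ := Submodule.Quotient.mk_surjective _ x
  induction x using TensorProduct.induction_on with
  | zero => rw [Submodule.Quotient.mk_zero, map_zero, map_zero]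
  | tmul n m => exact h n m
  | add x y hx hy => rw [Submodule.Quotient.mk_add, map_add, map_add, hx, hy]

variable (R)

/-- The functor `M ↦ N ⊗_R M` from left `R`-modules to `K`-modules, for a right `R`-module `N`
with a `K`-module structure. -/
def balancedTensor : ModuleCat.{u} R ⥤ ModuleCat.{u} K where
  obj M := ModuleCat.of K (BalancedTensor K R N M)
  map f := ModuleCat.ofHom (balancedMap K N f.hom)
  map_id _ := ModuleCat.hom_ext (balanced_ext fun _ _ => rfl)
  map_comp _ _ := ModuleCat.hom_ext (balanced_ext fun _ _ => rfl)

instance : (balancedTensor K R N).Additive where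
  map_add {_ _ f g} := ModuleCat.hom_ext (balanced_ext fun n m =>
    congrArg Submodule.Quotient.mk (TensorProduct.tmul_add n (f.hom m) (g.hom m)))

/-- `Tor_n^R(N, M)` as a `K`-module, for a right `R`-module `N` and a left `R`-module `M`: the
`n`-th left derived functor of `N ⊗_R -`, evaluated at `M`. -/
def torModule (M : Type u) [AddCommGroup M] [Module R M] (n : ℕ) : ModuleCat.{u} K :=
  ((balancedTensor K R N).leftDerived n).obj (ModuleCat.of R M)

end Tor

/-- The partial group homology `H^par_n(G, X) = Tor_n^{K_par G}(𝓑, X)` of `G` with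
coefficients in the left `K_par G`-module `X`. -/
def parHomology (K G : Type u) [CommRing K] [Group G] (X : Type u) [AddCommGroup X]
    [Module (KPar K G) X] (n : ℕ) : ModuleCat.{u} K :=
  torModule K (KPar K G) (Idem K G) X n

/-! ### The globalization -/

section Globalization

variable (K G : Type u) [CommRing K] [Group G] (X : Type u) [AddCommGroup X] [Module K X]
  [Module (KPar K G) X]

/-- The submodule of `KG ⊗ X` generated by the elements `g ⊗ [h] x - gh ⊗ e_{h⁻¹} x`. -/
def globRel : Submodule K (MonoidAlgebra K G ⊗[K] X) :=
  Submodule.span K {z | ∃ (g h : G) (x : X),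
    z = MonoidAlgebra.single g (1 : K) ⊗ₜ[K] (br K h • x) -
      MonoidAlgebra.single (g * h) (1 : K) ⊗ₜ[K] (idem K h⁻¹ • x)}

/-- The globalization `Λ(X)`. -/
abbrev Glob : Type u := (MonoidAlgebra K G ⊗[K] X) ⧸ globRel K G X

variable {G X} in
/-- The class `⌊g, x⌋` of `g ⊗ x` in `Λ(X)`. -/
def globMk (g : G) (x : X) : Glob K G X :=
  Submodule.Quotient.mk (MonoidAlgebra.single g (1 : K) ⊗ₜ[K] x)

/-- The action of `G` on `Λ(X)`, with `h · ⌊g, x⌋ = ⌊hg, x⌋`. -/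
def globRep : Representation K G (Glob K G X) where
  toFun h := Submodule.mapQ _ _
    (LinearMap.rTensor X (LinearMap.mulLeft K (MonoidAlgebra.single h (1 : K)))) (by
      rw [globRel, Submodule.span_le]
      rintro _ ⟨g, k, x, rfl⟩
      refine Submodule.subset_span ⟨h * g, k, x, ?_⟩
      simp [mul_assoc])
  map_one' := by
    ext x
    simp [← MonoidAlgebra.one_def]
  map_mul' h k := by
    ext x
    simp [MonoidAlgebra.single_mul_single, mul_assoc]

theorem globRep_globMk (h g : G) (x : X) :
    globRep K G X h (globMk K g x) = globMk K (h * g) x := by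
  change Submodule.Quotient.mk _ = Submodule.Quotient.mk _
  simp

variable {K G X}

/-- For a family `(X_t)` of submodules of `X`, the submodule `Λ(X)_g` of `Λ(X)`
generated by all `⌊h, x⌋` with `x ∈ X_s` and `h s h⁻¹ = g`. -/
def globPiece (P : G → Submodule K X) (g : G) : Submodule K (Glob K G X) :=
  Submodule.span K {z | ∃ (h s : G) (x : X), h * s * h⁻¹ = g ∧ x ∈ P s ∧ z = globMk K h x}

theorem globRep_mem_globPiece (P : G → Submodule K X) (g c : G) {z : Glob K G X}
    (hz : z ∈ globPiece P g) : globRep K G X c z ∈ globPiece P (c * g * c⁻¹) := by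
  induction hz using Submodule.span_induction with
  | mem z hz =>
    obtain ⟨h, s, x, hg, hx, rfl⟩ := hz
    rw [globRep_globMk]
    exact Submodule.subset_span ⟨c * h, s, x, by rw [← hg]; group, hx, rfl⟩
  | zero => simp
  | add x y _ _ hx hy => rw [map_add]; exact add_mem hx hy
  | smul a x _ hx => rw [map_smul]; exact Submodule.smul_mem _ _ hx

theorem centralizer_conj {g : G} (c : Subgroup.centralizer {g}) :
    (c : G) * g * (c : G)⁻¹ = g := by
  rw [Subgroup.mem_centralizer_singleton_iff.1 c.2, mul_inv_cancel_right]

/-- The action on `Λ(X)_g` of the centralizer of `g`, restricted from the action of `G`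
on `Λ(X)`. -/
def globPieceRep (P : G → Submodule K X) (g : G) :
    Representation K (Subgroup.centralizer {g}) (globPiece P g) where
  toFun c := (globRep K G X (c : G)).restrict fun z hz => by
    simpa only [centralizer_conj] using globRep_mem_globPiece P g c hz
  map_one' := by
    ext z : 2
    simp
  map_mul' c d := by
    ext z : 2
    simp

end Globalization

/-! ### Gradings compatible with conjugation -/

section Grading

open Classical in
/-- A `G`-grading `X = ⨁ X_t` of a `K_par G`-module `X` such that `[h] X_t ⊆ X_{hth⁻¹}`. -/
structure ConjGrading (K G : Type u) [CommRing K] [Group G] (X : Type u) [AddCommGroup X]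
    [Module K X] [Module (KPar K G) X] where
  piece : G → Submodule K X
  isInternal : DirectSum.IsInternal piece
  br_smul_mem : ∀ (h t : G) (x : X), x ∈ piece t → br K h • x ∈ piece (h * t * h⁻¹)

variable {K G : Type u} [CommRing K] [Group G] {X : Type u} [AddCommGroup X] [Module K X]
  [Module (KPar K G) X] [IsScalarTower K (KPar K G) X]

variable (K X) in
/-- The `K`-linear map `x ↦ [h] x` on `X`. -/
def brMap (h : G) : X →ₗ[K] X where
  toFun x := br K h • x
  map_add' := smul_add _
  map_smul' a x := by
    rw [RingHom.id_apply, ← algebraMap_smul (KPar K G) a x,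
      ← algebraMap_smul (KPar K G) a (br K h • x), smul_smul, smul_smul, Algebra.commutes]

@[simp] theorem brMap_apply (h : G) (x : X) : brMap K X h x = br K h • x := rfl

namespace ConjGrading

variable (𝒳 : ConjGrading K G X) (g : G)

/-- The `K_par G`-submodule `X_ḡ = ⨁ X_t`, the sum being over the conjugacy class of `g`. -/
def conjComponent : Submodule (KPar K G) X where
  __ := (⨆ (t : G) (_ : IsConj g t), 𝒳.piece t).toAddSubmonoid
  smul_mem' z x hx := by
    change x ∈ (⨆ (t : G) (_ : IsConj g t), 𝒳.piece t) at hx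
    change z • x ∈ (⨆ (t : G) (_ : IsConj g t), 𝒳.piece t)
    have key : ∀ (h : G) (x : X), x ∈ (⨆ (t : G) (_ : IsConj g t), 𝒳.piece t) →
        br K h • x ∈ (⨆ (t : G) (_ : IsConj g t), 𝒳.piece t) := by
      intro h x hx
      refine (iSup₂_le (a := (⨆ (t : G) (_ : IsConj g t), 𝒳.piece t).comap
        (brMap K X h)) fun t ht y hy => ?_) hx
      have hc : IsConj g (h * t * h⁻¹) := ht.trans (isConj_iff.2 ⟨h, rfl⟩)
      exact Submodule.mem_iSup_of_mem _ (Submodule.mem_iSup_of_mem hc (𝒳.br_smul_mem h t y hy))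
    induction z using MonoidAlgebra.induction_on generalizing x with
    | of w =>
      induction w using Exel.induction generalizing x with
      | one => rwa [map_one, one_smul]
      | mul t w ih =>
        rw [map_mul, mul_smul]
        exact key t _ (ih x hx)
    | add a b ha hb => rw [add_smul]; exact add_mem (ha x hx) (hb x hx)
    | smul r a ha => rw [smul_assoc]; exact Submodule.smul_mem _ _ (ha x hx)

open Classical in
/-- The homogeneous components of `X_ḡ`: `(X_ḡ)_t` is `X_t` if `t` is conjugate to `g`,
and zero otherwise. -/
def conjPiece (t : G) : Submodule K (𝒳.conjComponent g) :=
  if IsConj g t then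
    (𝒳.piece t).comap ((𝒳.conjComponent g).subtype.restrictScalars K)
  else ⊥

/-- The partial representation `c ↦ [c]|_{X_g}` on `X_g` of the centralizer of `g`, extended
to `K_par` of the centralizer. -/
def pieceAction :
    KPar K (Subgroup.centralizer {g}) →ₐ[K] Module.End K (𝒳.piece g) :=
  MonoidAlgebra.lift K _ _ <| Exel.lift
    (fun c => (brMap K X (c : G)).restrict fun x hx => by
      simpa only [centralizer_conj, brMap_apply] using 𝒳.br_smul_mem c g x hx)
    (by
      ext x : 2
      simp [br, Exel.br_one, ← MonoidAlgebra.one_def])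
    (fun s t => by
      ext x : 2
      have := congrArg (fun w => MonoidAlgebra.of K (Exel G) w • (x : X))
        (Exel.br_left (s : G) (t : G))
      simp only [map_mul, mul_smul] at this
      exact this)
    (fun s t => by
      ext x : 2
      have := congrArg (fun w => MonoidAlgebra.of K (Exel G) w • (x : X))
        (Exel.br_right (s : G) (t : G))
      simp only [map_mul, mul_smul] at this
      exact this)

/-- `X_g` is a module over `K_par` of the centralizer of `g`, where `[c]` acts as on `X`. -/
instance pieceModule : Module (KPar K (Subgroup.centralizer {g})) (𝒳.piece g) :=
  Module.compHom _ (𝒳.pieceAction g).toRingHom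

theorem piece_br_smul (c : Subgroup.centralizer {g}) (x : 𝒳.piece g) :
    ((br K c • x : 𝒳.piece g) : X) = br K (c : G) • (x : X) := by
  change ((𝒳.pieceAction g (br K c) x : 𝒳.piece g) : X) = _
  rw [pieceAction, PartialHomology.br, MonoidAlgebra.lift_of]
  rfl

end ConjGrading

end Grading

end PartialHomology

end

/-! Partial homology is ordinary homology of the globalization: `H^par_n(G, X) ≅ H_n(G, Λ(X))`.
Three facts give this. In degree zero, `𝓑 ⊗ X` is naturally `Λ(X)_G` (`balancedIsoCoinv`): the
coinvariants forget the group index, and the relation left over, `[h]x ~ e_{h⁻¹}x`, is the balancing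
relation at `1 ∈ 𝓑`, since `1 ◁ [h] = e_{h⁻¹}`. The functor `Λ` is exact (`globFunctor_shortExact`).
Finally `Λ` sends projectives to acyclic modules, because `Λ` of a free module is induced from the
trivial subgroup (`isZero_groupHomology_globRep_of_basis`). Dimension shifting along the syzygies of
a projective resolution then identifies the derived functors.

Exactness of `Λ` rests on the operators `globProj c`, `⌊g, x⌋ ↦ ⌊g, e_{g⁻¹c} x⌋ = ⌊c, [c⁻¹g] x⌋`.
They commute, and each `⌊c, x⌋` is fixed by one of them, so a finite product of operators `1 -
globProj c` kills any given element (`mem_of_forall_apply_mem`). Questions about `Λ(X)` thereby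
reduce to questions about `X`.

For a graded module, `⌊s, x⌋` with `x ∈ X_t` gets degree `s t s⁻¹`. The group permutes the degrees
of `Λ(X_ḡ)` transitively by conjugation, so `Λ(X_ḡ)` is induced from its degree `g` part, a
representation of the centralizer, and Shapiro's lemma gives the first isomorphism. For the second,
the globalization of `X_g` over the centralizer always embeds in `Λ(X_ḡ)_g`; the spanning hypothesis
makes the embedding onto. -/

noncomputable section

namespace PartialHomology

/-! ### Left derived functors by dimension shifting -/

section DimensionShift

open Limits

universe v₁ v₂ u₁ u₂

variable {C : Type u₁} [Category.{v₁} C] [Abelian C] {D : Type u₂} [Category.{v₂} D] [Abelian D]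

/-- The syzygy sequence `opcycles (n + 1) ⟶ X n ⟶ opcycles n` of a chain complex. -/
def syzygySequence (K : ChainComplex C ℕ) (n : ℕ) : ShortComplex C :=
  ShortComplex.mk (K.fromOpcycles (n + 1) n) (K.pOpcycles n) (by
    rw [← cancel_epi (K.pOpcycles (n + 1)), K.p_fromOpcycles_assoc, K.d_pOpcycles, comp_zero])

/-- Right exactness holds for any complex: the differential factors through the epimorphism onto
`opcycles (n + 1)`, so both maps to `X n` have the same cokernel. The kernel on the left is the
homology in degree `n + 1`. -/
theorem syzygySequence_shortExact (K : ChainComplex C ℕ) (n : ℕ) (h : K.ExactAt (n + 1)) :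
    (syzygySequence K n).ShortExact where
  exact := by
    have : Epi (syzygySequence K n).g := inferInstanceAs (Epi (K.pOpcycles n))
    have key {A : C} (k : K.X n ⟶ A) (hk : K.fromOpcycles (n + 1) n ≫ k = 0) :
        K.d (n + 1) n ≫ k = 0 := by
      rw [← K.p_fromOpcycles, Category.assoc, hk, comp_zero]
    exact ShortComplex.exact_of_g_is_cokernel _ (CokernelCofork.IsColimit.ofπ' _ _ fun k hk =>
      ⟨K.descOpcycles k (n + 1) (by simp) (key k hk), K.p_descOpcycles _ _ _ _⟩)
  mono_f := Preadditive.mono_of_isZero_kernel' _ (K.homologyIsKernel (n + 1) n (by simp))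
    h.isZero_homology
  epi_g := inferInstanceAs (Epi (K.pOpcycles n))

/-- A right exact functor commutes with the formation of opcycles. -/
def mapOpcycles (F : C ⥤ D) [F.Additive] [PreservesFiniteColimits F] (K : ChainComplex C ℕ)
    (n : ℕ) : ((F.mapHomologicalComplex _).obj K).opcycles n ≅ F.obj (K.opcycles n) :=
  IsColimit.coconePointUniqueUpToIso
    (((F.mapHomologicalComplex _).obj K).opcyclesIsCokernel (n + 1) n (by simp))
    (CokernelCofork.mapIsColimit _ (K.opcyclesIsCokernel (n + 1) n (by simp)) F)

theorem pOpcycles_mapOpcycles (F : C ⥤ D) [F.Additive] [PreservesFiniteColimits F]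
    (K : ChainComplex C ℕ) (n : ℕ) :
    ((F.mapHomologicalComplex _).obj K).pOpcycles n ≫ (mapOpcycles F K n).hom =
      F.map (K.pOpcycles n) :=
  IsColimit.comp_coconePointUniqueUpToIso_hom
    (((F.mapHomologicalComplex _).obj K).opcyclesIsCokernel (n + 1) n (by simp)) _
    WalkingParallelPair.one

theorem mapOpcycles_comp_map (F : C ⥤ D) [F.Additive] [PreservesFiniteColimits F]
    (K : ChainComplex C ℕ) (n : ℕ) :
    (mapOpcycles F K (n + 1)).hom ≫ F.map (K.fromOpcycles (n + 1) n) =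
      ((F.mapHomologicalComplex _).obj K).fromOpcycles (n + 1) n := by
  refine (cancel_epi (((F.mapHomologicalComplex _).obj K).pOpcycles (n + 1))).1 ?_
  refine (Category.assoc _ _ _).symm.trans ((congrArg (· ≫ _) (pOpcycles_mapOpcycles F K _)).trans
    ((F.map_comp _ _).symm.trans ((congrArg F.map (K.p_fromOpcycles _ _)).trans ?_)))
  exact (((F.mapHomologicalComplex _).obj K).p_fromOpcycles (n + 1) n).symm

/-- The homology of `F(K)` in positive degrees, for `F` right exact. -/
def homologyMapIso (F : C ⥤ D) [F.Additive] [PreservesFiniteColimits F] (K : ChainComplex C ℕ)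
    (n : ℕ) : ((F.mapHomologicalComplex _).obj K).homology (n + 1) ≅
      kernel (F.map (K.fromOpcycles (n + 1) n)) :=
  IsLimit.conePointUniqueUpToIso
      (((F.mapHomologicalComplex _).obj K).homologyIsKernel (n + 1) n (by simp))
      (kernelIsKernel (((F.mapHomologicalComplex _).obj K).fromOpcycles (n + 1) n)) ≪≫
    kernel.mapIso _ _ (mapOpcycles F K (n + 1)) (Iso.refl (F.obj (K.X n)))
      ((Category.comp_id _).trans (mapOpcycles_comp_map F K n).symm)

/-- `H n` plays the role of degree `n + 1`. Shifting down the syzygies reduces it to `H 0` of the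
`n`-th syzygy, and `zero` turns that into the kernel that computes the homology of `F` applied to
the resolution. Only the existence of the isomorphisms matters, so no naturality in `S` is required.
-/
theorem leftDerived_iso_of_dimensionShift [HasProjectiveResolutions C] (F : C ⥤ D) [F.Additive]
    [PreservesFiniteColimits F] (H : ℕ → C ⥤ D)
    (zero : ∀ S : ShortComplex C, S.ShortExact → Projective S.X₂ →
      Nonempty ((H 0).obj S.X₃ ≅ kernel (F.map S.f)))
    (succ : ∀ (n : ℕ) (S : ShortComplex C), S.ShortExact → Projective S.X₂ →
      Nonempty ((H (n + 1)).obj S.X₃ ≅ (H n).obj S.X₁)) (n : ℕ) (M : C) :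
    Nonempty ((F.leftDerived (n + 1)).obj M ≅ (H n).obj M) := by
  let P := projectiveResolution M
  have hS (k : ℕ) := syzygySequence_shortExact P.complex k (P.complex_exactAt_succ k)
  have shift (k m : ℕ) : Nonempty ((H (m + k)).obj (P.complex.opcycles 0) ≅
      (H m).obj (P.complex.opcycles k)) := by
    induction k generalizing m with
    | zero => exact ⟨Iso.refl _⟩
    | succ k ih =>
      obtain ⟨e⟩ := ih (m + 1)
      obtain ⟨e'⟩ := succ m _ (hS k) (P.projective k)
      exact ⟨eqToIso (by rw [Nat.add_right_comm, Nat.add_assoc]) ≪≫ e ≪≫ e'⟩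
  obtain ⟨e⟩ := shift n 0
  obtain ⟨e₀⟩ := zero _ (hS n) (P.projective n)
  let e₁ : P.complex.opcycles 0 ≅ M := IsColimit.coconePointUniqueUpToIso
    (P.complex.opcyclesIsCokernel 1 0 (by simp)) P.isColimitCokernelCofork
  exact ⟨P.isoLeftDerivedObj F (n + 1) ≪≫ homologyMapIso F P.complex n ≪≫ e₀.symm ≪≫ e.symm ≪≫
    eqToIso (by rw [Nat.zero_add]) ≪≫ (H n).mapIso e₁⟩

end DimensionShift

/-! ### Families of commuting operators -/

section CommutingOperators

variable {K V I : Type*} [CommRing K] [AddCommGroup V] [Module K V]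

/-- If `V` is spanned by vectors fixed by some operator of a commuting family `E`, then an element
of `V` whose images under all the operators lie in a stable submodule `N` lies in `N`. -/
theorem mem_of_forall_apply_mem (E : I → Module.End K V) (comm : ∀ i j, Commute (E i) (E j))
    (span : Submodule.span K {v | ∃ i, E i v = v} = ⊤) (N : Submodule K V)
    (stable : ∀ i, ∀ v ∈ N, E i v ∈ N) {z : V} (hz : ∀ i, E i z ∈ N) : z ∈ N := by
  -- Elements of `S` act on `z` as the identity modulo `N`, yet some element of `S` kills `z`.
  let S : Submonoid (Module.End K V) := Submonoid.closure (Set.range fun i => 1 - E i)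
  have Scomm : ∀ a ∈ S, ∀ b ∈ S, Commute a b := fun a ha b hb => by
    refine Submonoid.closure_induction₂ (motive := fun a b _ _ => Commute a b)
      ?_ ?_ ?_ ?_ ?_ ha hb
    · rintro _ _ ⟨i, rfl⟩ ⟨j, rfl⟩
      exact (Commute.one_left _).sub_left ((Commute.one_right _).sub_right (comm i j))
    · exact fun x _ => Commute.one_left x
    · exact fun x _ => Commute.one_right x
    · exact fun x y z _ _ _ h1 h2 => Commute.mul_left h1 h2
    · exact fun x y z _ _ _ h1 h2 => Commute.mul_right h1 h2
  have kill : ∀ v : V, ∃ a ∈ S, a v = 0 := fun v => by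
    have hv : v ∈ Submodule.span K {v | ∃ i, E i v = v} := span ▸ Submodule.mem_top
    induction hv using Submodule.span_induction with
    | mem v hv =>
      obtain ⟨i, hi⟩ := hv
      exact ⟨1 - E i, Submonoid.subset_closure ⟨i, rfl⟩, by simp [hi]⟩
    | zero => exact ⟨1, one_mem S, rfl⟩
    | add x y _ _ hx hy =>
      obtain ⟨a, ha, hax⟩ := hx
      obtain ⟨b, hb, hby⟩ := hy
      -- By commutativity the product of the two annihilators kills both summands.
      refine ⟨a * b, mul_mem ha hb, ?_⟩
      rw [map_add, Module.End.mul_apply a b y, hby, map_zero, (Scomm a ha b hb).eq,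
        Module.End.mul_apply, hax, map_zero, add_zero]
    | smul r x _ hx =>
      obtain ⟨a, ha, hax⟩ := hx
      exact ⟨a, ha, by rw [map_smul, hax, smul_zero]⟩
  have close : ∀ a ∈ S, (∀ v ∈ N, a v ∈ N) ∧ a z - z ∈ N := fun a ha => by
    induction ha using Submonoid.closure_induction with
    | mem a ha =>
      obtain ⟨i, rfl⟩ := ha
      refine ⟨fun v hv => N.sub_mem hv (stable i v hv), ?_⟩
      simpa using hz i
    | one => exact ⟨fun v hv => hv, by simp⟩
    | mul a b _ _ iha ihb =>
      refine ⟨fun v hv => iha.1 _ (ihb.1 v hv), ?_⟩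
      have := N.add_mem (iha.1 _ ihb.2) iha.2
      rwa [map_sub, sub_add_sub_cancel] at this
  obtain ⟨a, ha, haz⟩ := kill z
  simpa [haz] using (close a ha).2

end CommutingOperators

/-! ### Recognizing induced representations -/

section Induced

open Representation

variable {K : Type u} [CommRing K] {G : Type u} [Group G] {V : Type u} [AddCommGroup V]
  [Module K V]

/-- A representation of `G` generated by a submodule `W`, stable under a subgroup `H`, that has a
projection annihilating the translates `s W`, `s ∉ H`, is induced from `W`, so that
Shapiro's lemma applies. -/
theorem groupHomology_iso_of_projection (ρ : Representation K G V) (H : Subgroup G)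
    {W : Type u} [AddCommGroup W] [Module K W] (σ : Representation K H W)
    (j : W →ₗ[K] V) (hj : ∀ (c : H) (w : W), j (σ c w) = ρ (c : G) (j w))
    (p : V →ₗ[K] W) (hp : ∀ w, p (j w) = w) (hp' : ∀ s ∉ H, ∀ w, p (ρ s (j w)) = 0)
    (span : Submodule.span K {v | ∃ (s : G) (w : W), v = ρ s (j w)} = ⊤) (n : ℕ) :
    Nonempty (groupHomology (Rep.of ρ) n ≅ groupHomology (Rep.of σ) n) := by
  classical
  let A : Rep.{u} K H := Rep.of σ
  let f : A ⟶ Rep.res H.subtype (Rep.of ρ) := Rep.ofHom ⟨j, fun c => LinearMap.ext (hj c)⟩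
  -- `Φ` is adjoint to the inclusion `j`. The spanning hypothesis makes it surjective; the
  -- projection `p` makes it injective.
  let Φ : Rep.ind H.subtype A ⟶ Rep.of ρ := (Rep.indResHomEquiv H.subtype A (Rep.of ρ)).symm f
  let mk (s : G) : W →ₗ[K] IndV H.subtype σ := IndV.mk H.subtype σ s
  let φ : IndV H.subtype σ →ₗ[K] V := Φ.hom.toLinearMap
  have hφ (s : G) (w : W) : φ (mk s w) = ρ s⁻¹ (j w) := by
    change TensorProduct.lift (((Finsupp.lift (W →ₗ[K] V) K G) fun h => ρ h⁻¹ ∘ₗ j) ∘ₗ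
      (MonoidAlgebra.coeffLinearEquiv K).toLinearMap) (MonoidAlgebra.single s (1 : K) ⊗ₜ[K] w) = _
    simp
  have pφ (s h : G) (w : W) (hs : s * h⁻¹ ∈ H) : p (ρ s (φ (mk h w))) = σ ⟨_, hs⟩ w := by
    rw [hφ, ← Module.End.mul_apply, ← map_mul, ← hp (σ _ w), hj]
  have pφ' (s h : G) (w : W) (hs : s * h⁻¹ ∉ H) : p (ρ s (φ (mk h w))) = 0 := by
    rw [hφ, ← Module.End.mul_apply, ← map_mul, hp' _ hs]
  have mk_mul (c : H) (h : G) (w : W) : mk (c * h) (σ c w) = mk h w := by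
    have := Coinvariants.mk_self_apply
      (Representation.tprod ((leftRegular K G).comp H.subtype) σ) c
      (MonoidAlgebra.single h (1 : K) ⊗ₜ[K] w)
    simpa [mk] using this
  -- `E s` is the projection onto the summand indexed by the coset `H s`. It factors through `φ`,
  -- hence kills the kernel of `φ`, and the general criterion applies with `N = ⊥`.
  let E (s : G) : Module.End K (IndV H.subtype σ) := mk s ∘ₗ p ∘ₗ ρ s ∘ₗ φ
  have hE (s h : G) (w : W) (hs : s * h⁻¹ ∈ H) : E s (mk h w) = mk h w := by
    change mk s (p (ρ s (φ (mk h w)))) = _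
    rw [pφ s h w hs, ← mk_mul ⟨_, hs⟩ h w]
    simp
  have hE' (s h : G) (w : W) (hs : s * h⁻¹ ∉ H) : E s (mk h w) = 0 := by
    change mk s (p (ρ s (φ (mk h w)))) = _
    rw [pφ' s h w hs, map_zero]
  have inj : Function.Injective φ := by
    rw [← LinearMap.ker_eq_bot, LinearMap.ker_eq_bot']
    intro z hz
    refine (Submodule.mem_bot K).1 (mem_of_forall_apply_mem E (fun s t => ?_) ?_ ⊥ ?_ fun s => ?_)
    · refine IndV.hom_ext _ _ fun h => LinearMap.ext fun w => ?_
      change E s (E t (mk h w)) = E t (E s (mk h w))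
      by_cases hs : s * h⁻¹ ∈ H <;> by_cases ht : t * h⁻¹ ∈ H <;> simp [hE, hE', hs, ht]
    · rw [eq_top_iff]
      rintro z -
      induction z using Coinvariants.induction_on with
      | _ z =>
      induction z using TensorProduct.induction_on with
      | zero => rw [map_zero]; exact zero_mem _
      | add x y hx hy => rw [map_add]; exact add_mem hx hy
      | tmul a w =>
        induction a using MonoidAlgebra.induction_linear with
        | zero => rw [TensorProduct.zero_tmul, map_zero]; exact zero_mem _
        | add x y hx hy => rw [TensorProduct.add_tmul, map_add]; exact add_mem hx hy
        | single h r =>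
          have : MonoidAlgebra.single h r = r • MonoidAlgebra.single h (1 : K) := by simp
          rw [this, ← TensorProduct.smul_tmul', map_smul]
          exact Submodule.smul_mem _ _ (Submodule.subset_span ⟨h, hE h h w (by simp)⟩)
    · rintro s v hv
      rw [(Submodule.mem_bot K).1 hv, map_zero]
      exact zero_mem _
    · change mk s (p (ρ s (φ z))) ∈ _
      simp [hz]
  have surj : Function.Surjective φ := by
    rw [← LinearMap.range_eq_top, eq_top_iff, ← span, Submodule.span_le]
    rintro _ ⟨s, w, rfl⟩
    exact ⟨mk s⁻¹ w, by rw [hφ, inv_inv]⟩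
  have : Mono Φ := (Rep.mono_iff_injective Φ).2 inj
  have : Epi Φ := (Rep.epi_iff_surjective Φ).2 surj
  have : IsIso Φ := isIso_of_mono_of_epi Φ
  exact ⟨(groupHomology.functor K G n).mapIso (asIso Φ).symm ≪≫ groupHomology.indIso H A n⟩

end Induced

/-! ### Idempotents of Exel's semigroup and of the partial group algebra -/

section Idempotents

variable {G : Type u} [Group G]

namespace Exel

theorem e_mem_E (t : G) : e t ∈ E G := Submonoid.subset_closure ⟨t, rfl⟩

theorem inv_br (t : G) : (inv (br t)).unop = br t⁻¹ := rfl

theorem inv_of_mem_E {s : Exel G} (hs : s ∈ E G) : (inv s).unop = s := by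
  induction hs using Submonoid.closure_induction with
  | mem s hs =>
    obtain ⟨t, rfl⟩ := hs
    rw [e, map_mul, MulOpposite.unop_mul, inv_br, inv_br, inv_inv]
  | one => rw [map_one, MulOpposite.unop_one]
  | mul x y hx hy ihx ihy => rw [map_mul, MulOpposite.unop_mul, ihx, ihy, E_comm hy hx]

theorem inv_mul_self_mem_E (w : Exel G) : (inv w).unop * w ∈ E G := by
  simpa using inv_mul_E_mul w (one_mem (E G))

/-- Multiply `[g][h][h⁻¹] = [gh][h⁻¹]` by `[h]` on the right. This identity is what makes `⌊g, x⌋ ↦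
[g] x` well defined. -/
theorem br_mul_br (g h : G) : br g * br h = br (g * h) * e h⁻¹ := by
  have := congrArg (· * br h) (br_right g h)
  simp only [mul_assoc] at this
  rw [← mul_assoc (br h), br_inv_br] at this
  rw [this, e, inv_inv]

end Exel

variable (K : Type u) [CommRing K]

theorem idem_eq (t : G) : idem K t = MonoidAlgebra.of K (Exel G) (Exel.e t) :=
  (map_mul (MonoidAlgebra.of K (Exel G)) _ _).symm

theorem br_one : br K (1 : G) = 1 := by
  rw [br, Exel.br_one, map_one]

theorem br_mul_br (g h : G) : br K g * br K h = br K (g * h) * idem K h⁻¹ := by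
  simp only [idem_eq, br, ← map_mul, Exel.br_mul_br]

theorem idem_comm (g h : G) : idem K g * idem K h = idem K h * idem K g := by
  simp only [idem_eq, ← map_mul, Exel.e_comm]

theorem idem_mul_br (t : G) : idem K t * br K t = br K t := by
  simp only [idem, br, ← map_mul, Exel.br_inv_br]

/-- `K_par G` is generated by the `[t]` as a `K`-module with a multiplication. -/
theorem kpar_induction {p : KPar K G → Prop} (one : p 1) (br_mul : ∀ t w, p w → p (br K t * w))
    (add : ∀ a b, p a → p b → p (a + b)) (smul : ∀ (r : K) a, p a → p (r • a)) (z : KPar K G) :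
    p z := by
  induction z using MonoidAlgebra.induction_on with
  | of w =>
    induction w using Exel.induction with
    | one => rw [map_one]; exact one
    | mul t w ih => rw [map_mul]; exact br_mul t _ ih
  | add a b ha hb => exact add a b ha hb
  | smul r a ha => exact smul r a ha

end Idempotents

/-! ### The globalization as a functor -/

section Globalization

variable {K G : Type u} [CommRing K] [Group G] {X : Type u} [AddCommGroup X] [Module K X]
  [Module (KPar K G) X]

theorem globMk_br_smul (g h : G) (x : X) :
    globMk K g (br K h • x) = globMk K (g * h) (idem K h⁻¹ • x) :=
  (Submodule.Quotient.eq _).2 (Submodule.subset_span ⟨g, h, x, rfl⟩)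

variable (K X) in
/-- The linear map `x ↦ ⌊g, x⌋`. -/
def globMkₗ (g : G) : X →ₗ[K] Glob K G X :=
  (globRel K G X).mkQ ∘ₗ TensorProduct.mk K _ _ (MonoidAlgebra.single g (1 : K))

@[simp] theorem globMkₗ_apply (g : G) (x : X) : globMkₗ K X g x = globMk K g x := rfl

@[elab_as_elim]
theorem glob_induction {p : Glob K G X → Prop} (mk : ∀ g x, p (globMk K g x))
    (add : ∀ a b, p a → p b → p (a + b)) (z : Glob K G X) : p z := by
  have zero : p 0 := by
    have := mk 1 0
    rwa [← globMkₗ_apply, map_zero] at this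
  obtain ⟨z, rfl⟩ := Submodule.Quotient.mk_surjective _ z
  induction z using TensorProduct.induction_on with
  | zero => exact zero
  | add x y hx hy => exact add _ _ hx hy
  | tmul a x =>
    induction a using MonoidAlgebra.induction_linear with
    | zero => rwa [TensorProduct.zero_tmul]
    | add a b ha hb => rw [TensorProduct.add_tmul]; exact add _ _ ha hb
    | single g r =>
      have : MonoidAlgebra.single g r = r • MonoidAlgebra.single g (1 : K) := by simp
      rw [this, TensorProduct.smul_tmul]
      exact mk g (r • x)

theorem glob_hom_ext {V : Type*} [AddCommGroup V] [Module K V] {f f' : Glob K G X →ₗ[K] V}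
    (h : ∀ g x, f (globMk K g x) = f' (globMk K g x)) : f = f' := by
  refine LinearMap.ext fun z => ?_
  induction z using glob_induction with
  | mk g x => exact h g x
  | add a b ha hb => rw [map_add, map_add, ha, hb]

/-- Linear maps out of the globalization. -/
def globLift {V : Type*} [AddCommGroup V] [Module K V] (f : G → X →ₗ[K] V)
    (hf : ∀ g h x, f g (br K h • x) = f (g * h) (idem K h⁻¹ • x)) : Glob K G X →ₗ[K] V :=
  (globRel K G X).liftQ
    (TensorProduct.lift (Finsupp.lift _ K G f ∘ₗ (MonoidAlgebra.coeffLinearEquiv K).toLinearMap))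
    (by
      rw [globRel, Submodule.span_le]
      rintro _ ⟨g, h, x, rfl⟩
      simp [hf])

@[simp] theorem globLift_globMk {V : Type*} [AddCommGroup V] [Module K V] (f : G → X →ₗ[K] V)
    (hf) (g : G) (x : X) : globLift f hf (globMk K g x) = f g x := by
  change TensorProduct.lift (Finsupp.lift _ K G f ∘ₗ
    (MonoidAlgebra.coeffLinearEquiv K).toLinearMap) (MonoidAlgebra.single g (1 : K) ⊗ₜ[K] x) = _
  simp

variable [IsScalarTower K (KPar K G) X]

variable (K G X) in
/-- The map `Λ(X) → X`, `⌊g, x⌋ ↦ [g] x`. -/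
def globRetract : Glob K G X →ₗ[K] X :=
  globLift (fun g => brMap K X g) fun g h x => by
    simp only [brMap_apply, smul_smul, br_mul_br]

@[simp] theorem globRetract_globMk (g : G) (x : X) :
    globRetract K G X (globMk K g x) = br K g • x := globLift_globMk _ _ _ _

/-- The projection of `Λ(X)` onto the translate of the image of `X` by `c`. -/
def globProj (c : G) : Module.End K (Glob K G X) :=
  globMkₗ K X c ∘ₗ globRetract K G X ∘ₗ globRep K G X c⁻¹

theorem globProj_apply (c : G) (z : Glob K G X) :
    globProj c z = globMk K c (globRetract K G X (globRep K G X c⁻¹ z)) := rfl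

/-- In this form the group index is untouched and only an idempotent acts, so the operators commute
because the `e_t` do. -/
theorem globProj_globMk (c g : G) (x : X) :
    globProj c (globMk K g x) = globMk K g (idem K (g⁻¹ * c) • x) := by
  rw [globProj_apply, globRep_globMk, globRetract_globMk, globMk_br_smul, mul_inv_cancel_left,
    mul_inv_rev, inv_inv]

theorem globProj_comm (c d : G) : Commute (globProj (K := K) (X := X) c) (globProj d) :=
  glob_hom_ext fun g x => by
    simp only [Module.End.mul_apply, globProj_globMk, smul_smul, idem_comm]

theorem globProj_self (c : G) (x : X) : globProj c (globMk K c x) = globMk K c x := by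
  rw [globProj_globMk, inv_mul_cancel, idem, inv_one, br_one, mul_one, one_smul]

/-- Membership in a submodule of `Λ(X)` can be checked on the projections `globProj c`. -/
theorem mem_of_forall_globProj_mem (N : Submodule K (Glob K G X))
    (stable : ∀ c, ∀ v ∈ N, globProj c v ∈ N) {z : Glob K G X} (hz : ∀ c, globProj c z ∈ N) :
    z ∈ N := by
  refine mem_of_forall_apply_mem globProj globProj_comm (eq_top_iff.2 ?_) N stable hz
  rintro z -
  induction z using glob_induction with
  | mk g x => exact Submodule.subset_span ⟨g, globProj_self g x⟩
  | add a b ha hb => exact add_mem ha hb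

/-- The maps `z ↦ globRetract (c z)`, `c ∈ G`, are jointly injective, so injectivity of maps between
globalizations can be tested on the original modules. -/
theorem glob_eq_zero {z : Glob K G X}
    (hz : ∀ c, globRetract K G X (globRep K G X c z) = 0) : z = 0 := by
  refine (Submodule.mem_bot K).1 (mem_of_forall_globProj_mem ⊥ ?_ fun c => ?_)
  · intro c v hv
    rw [(Submodule.mem_bot K).1 hv, map_zero]
    exact zero_mem _
  · rw [globProj_apply, hz, ← globMkₗ_apply, map_zero]
    exact zero_mem _

/-! ### Functoriality and exactness of the globalization -/

section Map

variable {Y Z : Type u} [AddCommGroup Y] [Module K Y] [Module (KPar K G) Y]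
  [IsScalarTower K (KPar K G) Y] [AddCommGroup Z] [Module K Z] [Module (KPar K G) Z]
  [IsScalarTower K (KPar K G) Z]

variable (K) in
/-- The map `Λ(f)`. -/
def globMap (f : X →ₗ[KPar K G] Y) : Glob K G X →ₗ[K] Glob K G Y :=
  globLift (fun g => globMkₗ K Y g ∘ₗ f.restrictScalars K) fun g h x => by
    simp [globMk_br_smul]

@[simp] theorem globMap_globMk (f : X →ₗ[KPar K G] Y) (g : G) (x : X) :
    globMap K f (globMk K g x) = globMk K g (f x) := globLift_globMk _ _ _ _

theorem globMap_globRep (f : X →ₗ[KPar K G] Y) (g : G) (z : Glob K G X) :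
    globMap K f (globRep K G X g z) = globRep K G Y g (globMap K f z) := by
  induction z using glob_induction with
  | mk h x => simp only [globRep_globMk, globMap_globMk]
  | add a b ha hb => simp only [map_add, ha, hb]

theorem globRetract_globMap (f : X →ₗ[KPar K G] Y) (z : Glob K G X) :
    globRetract K G Y (globMap K f z) = f (globRetract K G X z) := by
  induction z using glob_induction with
  | mk h x => simp
  | add a b ha hb => simp only [map_add, ha, hb]

theorem globMap_injective {f : X →ₗ[KPar K G] Y} (hf : Function.Injective f) :
    Function.Injective (globMap K f) := by
  refine (injective_iff_map_eq_zero _).2 fun z hz => glob_eq_zero fun c => hf ?_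
  rw [← globRetract_globMap, globMap_globRep, hz, map_zero, map_zero, map_zero]

theorem globMap_surjective {f : X →ₗ[KPar K G] Y} (hf : Function.Surjective f) :
    Function.Surjective (globMap K f) := fun z => by
  induction z using glob_induction with
  | mk g y =>
    obtain ⟨x, rfl⟩ := hf y
    exact ⟨globMk K g x, globMap_globMk f g x⟩
  | add a b ha hb =>
    obtain ⟨x, rfl⟩ := ha
    obtain ⟨y, rfl⟩ := hb
    exact ⟨x + y, map_add _ _ _⟩

theorem globMap_exact {f : X →ₗ[KPar K G] Y} {f' : Y →ₗ[KPar K G] Z}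
    (h : Function.Exact f f') : Function.Exact (globMap K f) (globMap K f') := fun z => by
  have mem (c : G) {y : Y} (hy : f' y = 0) :
      globMk K c y ∈ LinearMap.range (globMap K f) := by
    obtain ⟨x, rfl⟩ := (h y).1 hy
    exact ⟨globMk K c x, globMap_globMk f c x⟩
  -- If `Λ(f')` kills `z`, then `f'` kills every `globRetract (c⁻¹ z)`, which puts `globProj c z` in
  -- the range of `Λ(f)`.
  refine ⟨fun hz => mem_of_forall_globProj_mem (LinearMap.range (globMap K f)) ?_ fun c => ?_, ?_⟩
  · rintro c _ ⟨v, rfl⟩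
    rw [globProj_apply, ← globMap_globRep, globRetract_globMap]
    exact mem c (h.apply_apply_eq_zero _)
  · rw [globProj_apply]
    refine mem c ?_
    rw [← globRetract_globMap, globMap_globRep, hz, map_zero, map_zero]
  · rintro ⟨v, rfl⟩
    induction v using glob_induction with
    | mk g x =>
      rw [globMap_globMk, globMap_globMk, h.apply_apply_eq_zero, ← globMkₗ_apply, map_zero]
    | add a b ha hb => rw [map_add, map_add, ha, hb, add_zero]

end Map

end Globalization

section Functor

variable (K G : Type u) [CommRing K] [Group G]

/-- Objects of the module category carry only the action of `K_par G`; restricting scalars supplies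
the `K`-structure that `Λ` uses. -/
instance kparModule (M : ModuleCat.{u} (KPar K G)) : Module K M :=
  Module.restrictScalars K (KPar K G) M

instance kparScalarTower (M : ModuleCat.{u} (KPar K G)) : IsScalarTower K (KPar K G) M :=
  IsScalarTower.restrictScalars K (KPar K G) M

/-- The globalization as a functor. -/
def globFunctor : ModuleCat.{u} (KPar K G) ⥤ Rep.{u} K G where
  obj M := Rep.of (globRep K G M)
  map f := Rep.ofHom ⟨globMap K f.hom, fun g => LinearMap.ext (globMap_globRep f.hom g)⟩
  map_id M := by
    ext : 1
    refine Representation.IntertwiningMap.ext (glob_hom_ext fun g x => ?_)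
    exact globMap_globMk _ _ _
  map_comp f f' := by
    ext : 1
    refine Representation.IntertwiningMap.ext (glob_hom_ext fun g x => ?_)
    simp

instance : (globFunctor K G).Additive where
  map_add {_ _ f f'} := by
    ext : 1
    refine Representation.IntertwiningMap.ext (glob_hom_ext fun g x => ?_)
    change globMap K (f + f').hom _ = globMap K f.hom _ + globMap K f'.hom _
    simp only [globMap_globMk, ModuleCat.hom_add, LinearMap.add_apply]
    exact map_add (globMkₗ K _ g) _ _

theorem globFunctor_shortExact {S : ShortComplex (ModuleCat.{u} (KPar K G))}
    (hS : S.ShortExact) : (S.map (globFunctor K G)).ShortExact where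
  exact := (forget₂ (Rep.{u} K G) (ModuleCat.{u} K)).reflects_exact_of_faithful _ <|
    (ShortComplex.ShortExact.moduleCat_exact_iff_function_exact _).2
      (globMap_exact ((ShortComplex.ShortExact.moduleCat_exact_iff_function_exact _).1 hS.exact))
  mono_f := (Rep.mono_iff_injective _).2
    (globMap_injective ((ModuleCat.mono_iff_injective _).1 hS.mono_f))
  epi_g := (Rep.epi_iff_surjective _).2
    (globMap_surjective ((ModuleCat.epi_iff_surjective _).1 hS.epi_g))

end Functor

/-! ### Coinvariants of the globalization -/

section Coinvariants

open Representation

variable {K G : Type u} [CommRing K] [Group G]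

theorem idemAlgebra_induction (p : KPar K G → Prop)
    (of : ∀ s ∈ Exel.E G, p (MonoidAlgebra.of K (Exel G) s))
    (add : ∀ a b, p a → p b → p (a + b)) (smul : ∀ (r : K) a, p a → p (r • a))
    {b : KPar K G} (hb : b ∈ idemAlgebra K G) : p b := by
  rw [← Subalgebra.mem_toSubmodule, idemAlgebra_eq_span] at hb
  induction hb using Submodule.span_induction with
  | mem b hb =>
    obtain ⟨s, hs, rfl⟩ := hb
    exact of s (Exel.mem_E_iff.2 hs)
  | zero => simpa using smul 0 _ (of 1 (one_mem _))
  | add x y _ _ hx hy => exact add x y hx hy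
  | smul r x _ hx => exact smul r x hx

theorem of_mem_idemAlgebra {s : Exel G} (hs : s ∈ Exel.E G) :
    MonoidAlgebra.of K (Exel G) s ∈ idemAlgebra K G :=
  Algebra.subset_adjoin ⟨s, Exel.mem_E_iff.1 hs, rfl⟩

theorem idem_mul_comm (t : G) {b : KPar K G} (hb : b ∈ idemAlgebra K G) :
    idem K t * b = b * idem K t := by
  refine idemAlgebra_induction (fun b => idem K t * b = b * idem K t)
    (fun s hs => ?_) (fun a b ha hb => ?_) (fun r a ha => ?_) hb
  · rw [idem_eq, ← map_mul, ← map_mul, Exel.E_comm (Exel.e_mem_E t) hs]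
  · rw [mul_add, add_mul, ha, hb]
  · rw [mul_smul_comm, smul_mul_assoc, ha]

/-- The element of `𝓑` given by an element of the subalgebra generated by the idempotents. -/
def toIdem (b : KPar K G) (hb : b ∈ idemAlgebra K G) : Idem K G := ⟨b, hb⟩

/-- The inclusion of `𝓑` in `K_par G`. -/
def idemVal : Idem K G →ₗ[K] KPar K G := (idemAlgebra K G).val.toLinearMap

theorem idemVal_mem (b : Idem K G) : idemVal b ∈ idemAlgebra K G := Subtype.property b

theorem idemVal_injective : Function.Injective (idemVal (K := K) (G := G)) :=
  Subtype.val_injective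

theorem idemVal_op_of_smul (w : Exel G) (b : Idem K G) :
    idemVal (MulOpposite.op (MonoidAlgebra.of K (Exel G) w) • b) =
      MonoidAlgebra.of K (Exel G) (Exel.inv w).unop *
        (idemVal b * MonoidAlgebra.of K (Exel G) w) := by
  change ((idemRightAction K G (MonoidAlgebra.of K (Exel G) w)).unop b : KPar K G) = _
  rw [idemRightAction, MonoidAlgebra.lift_of]
  rfl

theorem idemVal_op_br_smul (g : G) (b : Idem K G) :
    idemVal (MulOpposite.op (br K g) • b) = br K g⁻¹ * idemVal b * br K g :=
  idem_smul_br K G g b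

theorem op_smul_smul (r : K) (z : KPar K G) (b : Idem K G) :
    MulOpposite.op (r • z) • b = r • MulOpposite.op z • b := by
  change (idemRightAction K G (r • z)).unop b = r • (idemRightAction K G z).unop b
  rw [map_smul]
  rfl

/-- For an idempotent `s` of the semigroup, `s* = s`, so `1 ◁ s = s s = s`. Thus `1` generates `𝓑`
as a right module, and `b ⊗ x = 1 ⊗ b x`. -/
theorem op_smul_one {b : KPar K G} (hb : b ∈ idemAlgebra K G) :
    MulOpposite.op b • toIdem 1 (one_mem (idemAlgebra K G)) = toIdem b hb := by
  refine idemVal_injective (idemAlgebra_induction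
    (fun b => idemVal (MulOpposite.op b • toIdem 1 (one_mem (idemAlgebra K G))) = b)
    (fun s hs => ?_) (fun a b ha hb => ?_) (fun r a ha => ?_) hb)
  · rw [idemVal_op_of_smul, Exel.inv_of_mem_E hs]
    change _ * (1 * _) = _
    rw [one_mul, ← map_mul, (Exel.E_idem hs).eq]
  · rw [MulOpposite.op_add, add_smul, map_add, ha, hb]
  · rw [op_smul_smul, map_smul, ha]

variable {X : Type u} [AddCommGroup X] [Module K X] [Module (KPar K G) X]

variable (K G X) in
/-- The map `x ↦ ⌊1, x⌋` into the coinvariants of `Λ(X)`. -/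
def coinvMk : X →ₗ[K] Coinvariants (globRep K G X) :=
  Coinvariants.mk (globRep K G X) ∘ₗ globMkₗ K X 1

theorem coinvariants_mk_globMk (g : G) (x : X) :
    Coinvariants.mk (globRep K G X) (globMk K g x) = coinvMk K G X x := by
  have := Coinvariants.mk_self_apply (globRep K G X) g (globMk K 1 x)
  rwa [globRep_globMk, mul_one] at this

theorem coinvMk_br_smul (g : G) (x : X) :
    coinvMk K G X (br K g • x) = coinvMk K G X (idem K g⁻¹ • x) := by
  rw [← coinvariants_mk_globMk 1, globMk_br_smul, coinvariants_mk_globMk]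

variable [IsScalarTower K (KPar K G) X]

/-- This is the balancing of `(b, x) ↦ ⌊1, b x⌋`. For a generator, `[t⁻¹] b [t] x` has the class of
`e_t b [t] x`, and `e_t` commutes with `b` and is absorbed by `[t]`. -/
theorem coinvMk_op_smul (z : KPar K G) (b : Idem K G) (x : X) :
    coinvMk K G X (idemVal (MulOpposite.op z • b) • x) =
      coinvMk K G X (idemVal b • z • x) := by
  induction z using kpar_induction generalizing b x with
  | one => rw [MulOpposite.op_one, one_smul, one_smul]
  | br_mul t w ih =>
    rw [MulOpposite.op_mul, mul_smul, ih, idemVal_op_br_smul, mul_assoc, mul_smul,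
      coinvMk_br_smul, inv_inv, smul_smul (idem K t), ← mul_assoc, idem_mul_comm t (idemVal_mem b),
      mul_assoc, idem_mul_br, mul_smul, ← mul_smul (br K t)]
  | add a c ha hc =>
    simp only [MulOpposite.op_add, add_smul, smul_add, map_add, ha, hc]
  | smul r a ha =>
    rw [op_smul_smul, LinearMap.map_smul idemVal, smul_assoc, (coinvMk K G X).map_smul, ha, smul_smul (idemVal b),
      smul_smul (idemVal b), mul_smul_comm, smul_assoc, (coinvMk K G X).map_smul]

/-- The bilinear map `(b, x) ↦ ⌊1, b x⌋`. -/
def balancedToCoinvAux : Idem K G →ₗ[K] X →ₗ[ℤ] Coinvariants (globRep K G X) where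
  toFun b := ((coinvMk K G X).toAddMonoidHom.comp
    (DistribSMul.toAddMonoidHom X (idemVal b))).toIntLinearMap
  map_add' a b := LinearMap.ext fun x => by
    change coinvMk K G X (idemVal (a + b) • x) = coinvMk K G X _ + coinvMk K G X _
    rw [map_add, add_smul, map_add]
    rfl
  map_smul' r b := LinearMap.ext fun x => by
    change coinvMk K G X (idemVal (r • b) • x) = r • coinvMk K G X _
    rw [LinearMap.map_smul idemVal, smul_assoc, (coinvMk K G X).map_smul]
    rfl

variable (K G X) in
/-- The map `𝓑 ⊗ X → Λ(X)_G`, `b ⊗ x ↦ ⌊1, b x⌋`. -/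
def balancedToCoinv :
    BalancedTensor K (KPar K G) (Idem K G) X →ₗ[K] Coinvariants (globRep K G X) :=
  Submodule.liftQ _ (TensorProduct.AlgebraTensorModule.lift balancedToCoinvAux) (by
    rw [balancedRel, Submodule.span_le]
    rintro _ ⟨b, r, x, rfl⟩
    change TensorProduct.AlgebraTensorModule.lift balancedToCoinvAux _ = 0
    rw [map_sub, TensorProduct.AlgebraTensorModule.lift_tmul,
      TensorProduct.AlgebraTensorModule.lift_tmul, sub_eq_zero]
    exact coinvMk_op_smul r b x)

theorem balancedToCoinv_mk (b : Idem K G) (x : X) :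
    balancedToCoinv K G X (balancedMk K (Idem K G) b x) = coinvMk K G X (idemVal b • x) := rfl

theorem balancedMk_smul {R : Type u} [Ring R] {N : Type u} [AddCommGroup N]
    [Module K N] [Module Rᵐᵒᵖ N] {M : Type u} [AddCommGroup M] [Module R M] (n : N) (r : R)
    (m : M) : balancedMk (R := R) K N n (r • m) = balancedMk (R := R) K N (MulOpposite.op r • n) m := by
  symm
  exact (Submodule.Quotient.eq _).2 (Submodule.subset_span ⟨n, r, m, rfl⟩)

/-- The map `X → 𝓑 ⊗ X`, `x ↦ 1 ⊗ x`. -/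
def oneBalanced : X →ₗ[K] BalancedTensor K (KPar K G) (Idem K G) X where
  toFun x := balancedMk K (Idem K G) (toIdem 1 (one_mem (idemAlgebra K G))) x
  map_add' x y := congrArg Submodule.Quotient.mk (TensorProduct.tmul_add _ x y)
  map_smul' r x := by
    have h : r • x = (r • (1 : KPar K G)) • x := by rw [smul_assoc, one_smul]
    rw [h, balancedMk_smul, op_smul_smul, MulOpposite.op_one, one_smul]
    rfl

theorem oneBalanced_smul (z : KPar K G) (x : X) :
    oneBalanced (K := K) (G := G) (z • x) =
      balancedMk K (Idem K G) (MulOpposite.op z • toIdem 1 (one_mem (idemAlgebra K G))) x :=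
  balancedMk_smul _ _ _

theorem oneBalanced_smul_of_mem (b : Idem K G) (x : X) :
    oneBalanced (K := K) (G := G) (idemVal b • x) = balancedMk K (Idem K G) b x := by
  rw [oneBalanced_smul, op_smul_one (idemVal_mem b)]
  rfl

variable (K G X) in
/-- The map `Λ(X)_G → 𝓑 ⊗ X`, `⌊g, x⌋ ↦ 1 ⊗ x`. -/
def coinvToBalanced :
    Coinvariants (globRep K G X) →ₗ[K] BalancedTensor K (KPar K G) (Idem K G) X :=
  Coinvariants.lift _ (globLift (fun _ => oneBalanced) fun _ h x => by
    have hm : idem K h⁻¹ ∈ idemAlgebra K G := by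
      rw [idem_eq]
      exact of_mem_idemAlgebra (Exel.e_mem_E h⁻¹)
    rw [oneBalanced_smul, oneBalanced_smul, op_smul_one hm]
    congr 1
    refine idemVal_injective ?_
    rw [idemVal_op_br_smul]
    change br K h⁻¹ * 1 * br K h = idem K h⁻¹
    rw [mul_one, idem, inv_inv]) fun g => glob_hom_ext fun h x => by
      rw [LinearMap.comp_apply, globRep_globMk, globLift_globMk, globLift_globMk]

theorem coinvToBalanced_coinvMk (x : X) :
    coinvToBalanced K G X (coinvMk K G X x) = oneBalanced x := by
  rw [coinvToBalanced, coinvMk, LinearMap.comp_apply, Coinvariants.lift_mk, globMkₗ_apply,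
    globLift_globMk]

variable (K G X) in
/-- The isomorphism `𝓑 ⊗ X ≃ Λ(X)_G`. -/
def balancedEquivCoinv :
    BalancedTensor K (KPar K G) (Idem K G) X ≃ₗ[K] Coinvariants (globRep K G X) :=
  LinearEquiv.ofLinearMap (balancedToCoinv K G X) (coinvToBalanced K G X)
    (Coinvariants.hom_ext (glob_hom_ext fun g x => by
      simp only [LinearMap.comp_apply, coinvariants_mk_globMk, coinvToBalanced_coinvMk,
        LinearMap.id_apply]
      exact congrArg (coinvMk K G X) (one_smul _ x)))
    (balanced_ext fun b x => by
      rw [LinearMap.comp_apply, balancedToCoinv_mk, coinvToBalanced_coinvMk,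
        oneBalanced_smul_of_mem, LinearMap.id_apply])

variable (K G) in
/-- The isomorphism `𝓑 ⊗ X ≅ Λ(X)_G` is natural. -/
def balancedIsoCoinv : balancedTensor K (KPar K G) (Idem K G) ≅
    globFunctor K G ⋙ Rep.coinvariantsFunctor K G :=
  NatIso.ofComponents (fun M => (balancedEquivCoinv K G M).toModuleIso) fun {M N} f =>
    ModuleCat.hom_ext (balanced_ext fun b x => by
      change coinvMk K G N (idemVal b • f.hom x) =
        Coinvariants.mk (globRep K G N) (globMap K f.hom (globMk K 1 (idemVal b • x)))
      rw [globMap_globMk, coinvariants_mk_globMk, f.hom.map_smul])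

end Coinvariants

/-! ### Partial homology is the homology of the globalization -/

section Acyclic

open Representation Limits

variable {K G : Type u} [CommRing K] [Group G]

/-- The idempotent `s` is carried along so that the induction can peel off one letter at a time: `s
[t] = [t] ([t⁻¹] s [t])`, and `[t]` then moves across the tensor sign. -/
theorem globMk_of_mul_smul {X : Type u} [AddCommGroup X] [Module K X] [Module (KPar K G) X]
    (w : Exel G) {s : Exel G} (hs : s ∈ Exel.E G) (g : G) (x : X) :
    globMk K g (MonoidAlgebra.of K (Exel G) (s * w) • x) =
      globMk K (g * Exel.deg w) (MonoidAlgebra.of K (Exel G) ((Exel.inv w).unop * s * w) • x) := by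
  induction w using Exel.induction generalizing s g with
  | one => simp
  | mul t w ih =>
    have h1 : Exel.br t * ((Exel.br t⁻¹ * s * Exel.br t) * w) = s * (Exel.br t * w) := by
      have := Exel.E_comm hs (Exel.e_mem_E t)
      rw [Exel.e, ← mul_assoc] at this
      simp only [← mul_assoc]
      rw [← this, mul_assoc s, mul_assoc s, Exel.br_inv_br]
    have h2 : Exel.e t⁻¹ * ((Exel.br t⁻¹ * s * Exel.br t) * w) =
        (Exel.br t⁻¹ * s * Exel.br t) * w := by
      rw [Exel.e]
      simp only [← mul_assoc]
      rw [Exel.br_inv_br]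
    rw [← h1, map_mul _ (Exel.br t), mul_smul]
    refine (globMk_br_smul g t _).trans ?_
    have hs' : Exel.br t⁻¹ * s * Exel.br t ∈ Exel.E G := Exel.inv_mul_E_mul (Exel.br t) hs
    have h3 : (Exel.inv (Exel.br t * w)).unop * s * (Exel.br t * w) =
        (Exel.inv w).unop * (Exel.br t⁻¹ * s * Exel.br t) * w := by
      rw [map_mul, MulOpposite.unop_mul, Exel.inv_br]
      simp only [mul_assoc]
    have h4 : g * Exel.deg (Exel.br t * w) = g * t * Exel.deg w := by
      rw [map_mul, mul_assoc]
      rfl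
    rw [idem_eq, smul_smul, ← map_mul, h2, ih hs', h3, h4]

theorem globMk_of_smul {X : Type u} [AddCommGroup X] [Module K X] [Module (KPar K G) X]
    (w : Exel G) (g : G) (x : X) :
    globMk K g (MonoidAlgebra.of K (Exel G) w • x) =
      globMk K (g * Exel.deg w) (MonoidAlgebra.of K (Exel G) ((Exel.inv w).unop * w) • x) := by
  simpa using globMk_of_mul_smul (K := K) w (one_mem (Exel.E G)) g x

/-- The homology of the globalization of a free module vanishes in positive degrees. -/
theorem isZero_groupHomology_globRep_of_basis {X I : Type u} [AddCommGroup X] [Module K X]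
    [Module (KPar K G) X] [IsScalarTower K (KPar K G) X] (b : Module.Basis I (KPar K G) X) (n : ℕ) :
    IsZero (groupHomology (Rep.of (globRep K G X)) (n + 1)) := by
  classical
  let B : Module.Basis (Exel G × I) K X :=
    Module.Basis.smulTower (MonoidAlgebra.basis (Exel G) K) b
  have hB (w : Exel G) (i : I) : B (w, i) = MonoidAlgebra.of K (Exel G) w • b i := by
    simp [B]
  have of_smul_B (v w : Exel G) (i : I) :
      MonoidAlgebra.of K (Exel G) v • B (w, i) = B (v * w, i) := by
    rw [hB, hB, smul_smul, ← map_mul]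
  -- The aim is that `Λ(X)` is free over `KG` on the `⌊1, s bᵢ⌋` with `s` idempotent, that is,
  -- induced from the trivial subgroup.
  let σ : Representation K (⊥ : Subgroup G) (Exel.E G × I →₀ K) := 1
  let j : (Exel.E G × I →₀ K) →ₗ[K] Glob K G X := Finsupp.linearCombination K fun a => globMk K 1 (B (a.1, a.2))
  -- Since `⌊g, w bᵢ⌋ = ⌊g deg w, w* w bᵢ⌋`, the coefficient at `1 ∈ G` is nonzero only when `g deg
  -- w = 1`, and it then sits at `(w* w, i)`.
  let q (g : G) : X →ₗ[K] (Exel.E G × I →₀ K) := B.constr K fun a =>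
    if g * Exel.deg a.1 = 1 then
      Finsupp.single (⟨(Exel.inv a.1).unop * a.1, Exel.inv_mul_self_mem_E a.1⟩, a.2) 1
    else 0
  let p : Glob K G X →ₗ[K] (Exel.E G × I →₀ K) := globLift q fun g h x => by
    refine LinearMap.congr_fun (f := q g ∘ₗ brMap K X h)
      (g := q (g * h) ∘ₗ (Algebra.lsmul K K X (idem K h⁻¹))) (B.ext fun ⟨w, i⟩ => ?_) x
    change q g (br K h • B (w, i)) = q (g * h) (idem K h⁻¹ • B (w, i))
    rw [idem_eq, of_smul_B, br, of_smul_B]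
    simp only [q, Module.Basis.constr_basis, map_mul, Exel.deg_E (Exel.e_mem_E h⁻¹), one_mul,
      mul_assoc]
    have : Exel.deg (Exel.br h) = h := rfl
    rw [this]
    -- With `e = e_{h⁻¹}`, both `([h] w)* ([h] w)` and `(e w)* (e w)` equal `w* e w`.
    congr 4
    simp only [MulOpposite.unop_mul, Exel.inv_of_mem_E (Exel.e_mem_E h⁻¹), Exel.inv_br]
    rw [mul_assoc, mul_assoc, ← mul_assoc (Exel.e h⁻¹), Exel.e_idem, Exel.e, inv_inv, mul_assoc]
  have hj (a : Exel.E G × I) : j (Finsupp.single a 1) = globMk K 1 (B (a.1, a.2)) := by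
    simp [j]
  have hp (g : G) (a : Exel G × I) : p (globMk K g (B a)) = if g * Exel.deg a.1 = 1 then
      Finsupp.single (⟨(Exel.inv a.1).unop * a.1, Exel.inv_mul_self_mem_E a.1⟩, a.2) 1
    else 0 := by
    exact (globLift_globMk q _ g (B a)).trans (B.constr_basis K _ a)
  have pj : p ∘ₗ j = LinearMap.id := by
    refine Finsupp.lhom_ext' fun a => LinearMap.ext_ring ?_
    change p (j (Finsupp.single a 1)) = Finsupp.single a 1
    rw [hj, hp, if_pos (by rw [Exel.deg_E a.1.2, one_mul])]
    congr 1
    exact Prod.ext (Subtype.ext (show (Exel.inv a.1.1).unop * a.1.1 = a.1.1 by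
      rw [Exel.inv_of_mem_E a.1.2, (Exel.E_idem a.1.2).eq])) rfl
  have pj' (s : G) (hs : s ∉ (⊥ : Subgroup G)) : p ∘ₗ globRep K G X s ∘ₗ j = 0 := by
    refine Finsupp.lhom_ext' fun a => LinearMap.ext_ring ?_
    change p (globRep K G X s (j (Finsupp.single a 1))) = 0
    rw [hj, globRep_globMk, hp, if_neg]
    rwa [Exel.deg_E a.1.2, mul_one, mul_one]
  have span : Submodule.span K {v | ∃ (s : G) (w : Exel.E G × I →₀ K),
      v = globRep K G X s (j w)} = ⊤ := by
    refine eq_top_iff.2 ?_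
    rintro z -
    induction z using glob_induction with
    | mk g x =>
      rw [← globMkₗ_apply]
      induction B.mem_span x using Submodule.span_induction with
      | mem x hx =>
        obtain ⟨⟨w, i⟩, rfl⟩ := hx
        refine Submodule.subset_span ⟨g * Exel.deg w, Finsupp.single
          (⟨(Exel.inv w).unop * w, Exel.inv_mul_self_mem_E w⟩, i) 1, ?_⟩
        rw [hj, globRep_globMk, mul_one, hB, hB, globMkₗ_apply]
        exact globMk_of_smul w g (b i)
      | zero => rw [map_zero]; exact zero_mem _
      | add x y _ _ hx hy => rw [map_add]; exact add_mem hx hy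
      | smul r x _ hx => rw [map_smul]; exact Submodule.smul_mem _ r hx
    | add x y hx hy => exact add_mem hx hy
  obtain ⟨e⟩ := groupHomology_iso_of_projection (globRep K G X) ⊥ σ j
    (fun c w => by
      obtain rfl := Subsingleton.elim c 1
      simp)
    p (LinearMap.congr_fun pj) (fun s hs => LinearMap.congr_fun (pj' s hs)) span (n + 1)
  exact (isZero_groupHomology_succ_of_subsingleton _ n).of_iso e

/-- A projective module is a retract of a free one, and a retract of a zero object is zero. -/
theorem isZero_groupHomology_globFunctor (M : ModuleCat.{u} (KPar K G)) [Projective M] (n : ℕ) :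
    IsZero (groupHomology ((globFunctor K G).obj M) (n + 1)) := by
  have : Module.Projective (KPar K G) M := by
    rw [IsProjective.iff_projective]
    assumption
  obtain ⟨s, hs⟩ := Module.Projective.out (R := KPar K G) (P := M)
  let F : ModuleCat.{u} (KPar K G) := ModuleCat.of _ (M →₀ KPar K G)
  let i : M ⟶ F := ModuleCat.ofHom s
  let r : F ⟶ M := ModuleCat.ofHom (Finsupp.linearCombination _ id)
  have hir : i ≫ r = 𝟙 M := ModuleCat.hom_ext (LinearMap.ext hs)
  let T := globFunctor K G ⋙ groupHomology.functor K G (n + 1)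
  have hF : IsZero (T.obj F) := @isZero_groupHomology_globRep_of_basis K G _ _ F M _
    (kparModule K G F) _ (kparScalarTower K G F) Finsupp.basisSingleOne n
  refine (IsZero.iff_id_eq_zero (T.obj M)).2 ?_
  rw [← T.map_id, ← hir, T.map_comp, hF.eq_of_tgt (T.map i) 0, zero_comp]

variable (K G) in
-- Right exactness is transported from `Λ(-)_G`, a composite of an exact and a right exact functor.
theorem preservesFiniteColimits_balancedTensor :
    PreservesFiniteColimits (balancedTensor K (KPar K G) (Idem K G)) := by
  have h1 : PreservesFiniteColimits (globFunctor K G) :=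
    (Functor.preservesFiniteColimits_iff_forall_exact_map_and_epi _).2 fun S hS =>
      ⟨(globFunctor_shortExact K G hS).exact, (globFunctor_shortExact K G hS).epi_g⟩
  have h2 : PreservesFiniteColimits (globFunctor K G ⋙ Rep.coinvariantsFunctor K G) :=
    comp_preservesFiniteColimits _ _
  exact preservesFiniteColimits_of_natIso (balancedIsoCoinv K G).symm

/-- In degree one, the homology of a globalization is computed by a projective presentation. -/
theorem groupHomology_one_iso_kernel {S : ShortComplex (ModuleCat.{u} (KPar K G))}
    (hS : S.ShortExact) [Projective S.X₂] :
    Nonempty (groupHomology ((globFunctor K G).obj S.X₃) 1 ≅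
      kernel ((balancedTensor K (KPar K G) (Idem K G)).map S.f)) := by
  have hS' := globFunctor_shortExact K G hS
  -- Because `H_1(G, Λ(X₂)) = 0`, the connecting map identifies `H_1(G, Λ(X₃))` with the kernel of
  -- the map on coinvariants.
  have : Mono (groupHomology.δ hS' 1 0 rfl) :=
    groupHomology.mono_δ_of_isZero hS' 0 (isZero_groupHomology_globFunctor S.X₂ 0)
  have hex := groupHomology.mapShortComplex₁_exact hS' (i := 1) (j := 0) rfl
  have : Mono (groupHomology.mapShortComplex₁ hS' (i := 1) (j := 0) rfl).f := this
  have e1 := groupHomology.map_id_comp_H0Iso_hom ((globFunctor K G).map S.f)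
  have e2 := (balancedIsoCoinv K G).inv.naturality S.f
  exact ⟨IsLimit.conePointUniqueUpToIso hex.fIsKernel (kernelIsKernel _) ≪≫
    kernel.mapIso _ _ (groupHomology.H0Iso _ ≪≫ ((balancedIsoCoinv K G).app S.X₁).symm)
      (groupHomology.H0Iso _ ≪≫ ((balancedIsoCoinv K G).app S.X₂).symm)
      ((Category.assoc _ _ _).symm.trans ((congrArg (· ≫ _) e1).trans
        ((Category.assoc _ _ _).trans ((congrArg (_ ≫ ·) e2).trans
          (Category.assoc _ _ _).symm))))⟩

theorem leftDerived_iso_groupHomology (M : ModuleCat.{u} (KPar K G)) (n : ℕ) :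
    Nonempty (((balancedTensor K (KPar K G) (Idem K G)).leftDerived n).obj M ≅
      groupHomology ((globFunctor K G).obj M) n) := by
  have := preservesFiniteColimits_balancedTensor K G
  cases n with
  | zero =>
    exact ⟨(Functor.leftDerivedZeroIsoSelf _).app M ≪≫ (balancedIsoCoinv K G).app M ≪≫
      (groupHomology.H0Iso _).symm⟩
  | succ n =>
    refine leftDerived_iso_of_dimensionShift _
      (fun n => globFunctor K G ⋙ groupHomology.functor K G (n + 1))
      (fun S hS _ => groupHomology_one_iso_kernel hS) (fun n S hS _ => ?_) n M
    -- The middle term is acyclic in the two degrees flanking the connecting map.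
    have : IsIso (groupHomology.δ (globFunctor_shortExact K G hS) (n + 2) (n + 1) rfl) :=
      groupHomology.isIso_δ_of_isZero (globFunctor_shortExact K G hS) (n + 1)
      (isZero_groupHomology_globFunctor S.X₂ (n + 1)) (isZero_groupHomology_globFunctor S.X₂ n)
    exact ⟨@asIso _ _ _ _ _ this⟩

/-- Partial group homology is the homology of the globalization. -/
theorem parHomology_iso_groupHomology (X : Type u) [AddCommGroup X] [inst : Module K X]
    [Module (KPar K G) X] [IsScalarTower K (KPar K G) X] (n : ℕ) :
    Nonempty (parHomology K G X n ≅ groupHomology (Rep.of (globRep K G X)) n) := by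
  -- The scalar tower forces the given `K`-structure to be the restricted one.
  obtain rfl : inst = kparModule K G (ModuleCat.of (KPar K G) X) := by
    refine Module.ext' _ _ fun r x => ?_
    exact (algebraMap_smul (KPar K G) r x).symm
  exact leftDerived_iso_groupHomology (ModuleCat.of (KPar K G) X) n

end Acyclic

/-! ### The globalization of a graded module -/

section GradedGlobalization

variable {K G : Type u} [CommRing K] [Group G] {Y : Type u} [AddCommGroup Y] [Module K Y]
  [Module (KPar K G) Y] [IsScalarTower K (KPar K G) Y]

/-- It suffices to check homogeneous `y`; conjugation by `h` is injective, so distinct degrees stay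
distinct. -/
theorem proj_br_smul (P : G → Submodule K Y) (hP : ⨆ t, P t = ⊤)
    (hbr : ∀ (h t : G) (y : Y), y ∈ P t → br K h • y ∈ P (h * t * h⁻¹))
    (q : G → Y →ₗ[K] Y) (hq : ∀ t, ∀ y ∈ P t, q t y = y)
    (hq' : ∀ t t', t ≠ t' → ∀ y ∈ P t', q t y = 0) (h t : G) (y : Y) :
    q (h * t * h⁻¹) (br K h • y) = br K h • q t y := by
  have key : (⊤ : Submodule K Y) ≤
      LinearMap.eqLocus (q (h * t * h⁻¹) ∘ₗ brMap K Y h) (brMap K Y h ∘ₗ q t) := by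
    rw [← hP]
    refine iSup_le fun t' y hy => ?_
    change q (h * t * h⁻¹) (br K h • y) = br K h • q t y
    by_cases ht : t = t'
    · subst ht
      rw [hq _ _ hy, hq _ _ (hbr h t y hy)]
    · rw [hq' _ _ ht y hy, smul_zero, hq' _ (h * t' * h⁻¹) _ _ (hbr h t' y hy)]
      simpa using ht
  exact key (x := y) trivial

/-- If the degrees of a graded module are all conjugate to `g`, the homology of `Λ(Y)`
is that of the centralizer of `g` with coefficients in `Λ(Y)_g`. -/
theorem groupHomology_globRep_iso_globPieceRep (P : G → Submodule K Y) (hP : ⨆ t, P t = ⊤)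
    (hbr : ∀ (h t : G) (y : Y), y ∈ P t → br K h • y ∈ P (h * t * h⁻¹))
    (q : G → Y →ₗ[K] Y) (hq : ∀ t, ∀ y ∈ P t, q t y = y)
    (hq' : ∀ t t', t ≠ t' → ∀ y ∈ P t', q t y = 0) (g : G)
    (hqmem : ∀ t, IsConj g t → ∀ y, q t y ∈ P t)
    (hconj : ∀ t, ¬ IsConj g t → P t = ⊥) (n : ℕ) :
    Nonempty (groupHomology (Rep.of (globRep K G Y)) n ≅
      groupHomology (Rep.of (globPieceRep P g)) n) := by
  have equivariant := proj_br_smul P hP hbr q hq hq'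
  -- The projection onto degree `g`: the class `⌊s, y⌋` has degree `g` exactly when `y` has degree
  -- `s⁻¹ g s`.
  let p₀ : Glob K G Y →ₗ[K] Glob K G Y :=
    globLift (fun s => globMkₗ K Y s ∘ₗ q (s⁻¹ * g * s)) fun s h x => by
      have h1 : s⁻¹ * g * s = h * ((s * h)⁻¹ * g * (s * h)) * h⁻¹ := by group
      simp only [LinearMap.comp_apply, globMkₗ_apply]
      rw [h1, equivariant, globMk_br_smul, idem, mul_smul, mul_smul]
      congr 1
      have h2 : (s * h)⁻¹ * g * (s * h) =
          h⁻¹ * (h * ((s * h)⁻¹ * g * (s * h)) * h⁻¹) * h⁻¹⁻¹ := by group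
      rw [inv_inv]
      conv_rhs => rw [h2, equivariant, equivariant]
  have hp₀ (s : G) (y : Y) : p₀ (globMk K s y) = globMk K s (q (s⁻¹ * g * s) y) :=
    globLift_globMk _ _ _ _
  have mem (z : Glob K G Y) : p₀ z ∈ globPiece P g := by
    induction z using glob_induction with
    | mk s y =>
      rw [hp₀]
      exact Submodule.subset_span ⟨s, s⁻¹ * g * s, _, by group,
        hqmem _ (isConj_iff.2 ⟨s⁻¹, by group⟩) y, rfl⟩
    | add a b ha hb => rw [map_add]; exact add_mem ha hb
  refine groupHomology_iso_of_projection (globRep K G Y) (Subgroup.centralizer {g})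
    (globPieceRep P g) (globPiece P g).subtype (fun _ _ => rfl) (p₀.codRestrict _ mem)
    (fun w => ?_) (fun s hs w => ?_) ?_ n
  · obtain ⟨w, hw⟩ := w
    refine Subtype.ext ?_
    change p₀ w = w
    induction hw using Submodule.span_induction with
    | mem w hw =>
      obtain ⟨h, t, y, rfl, hy, rfl⟩ := hw
      have : h⁻¹ * (h * t * h⁻¹) * h = t := by group
      rw [hp₀, this, hq t y hy]
    | zero => exact map_zero _
    | add x y _ _ hx hy => rw [map_add, hx, hy]
    | smul r x _ hx => rw [map_smul, hx]
  · obtain ⟨w, hw⟩ := w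
    refine Subtype.ext ?_
    change p₀ (globRep K G Y s w) = 0
    induction hw using Submodule.span_induction with
    | mem w hw =>
      obtain ⟨h, t, y, hg, hy, rfl⟩ := hw
      rw [globRep_globMk, hp₀, hq' _ t _ y hy, ← globMkₗ_apply, map_zero]
      intro ht
      -- The translate by `s` has degree `s g s⁻¹`, so surviving `p₀` would force `s` to centralize
      -- `g`.
      refine hs (Subgroup.mem_centralizer_singleton_iff.2 ?_)
      have h1 : s⁻¹ * g * s = h * ((s * h)⁻¹ * g * (s * h)) * h⁻¹ := by group
      rw [ht, hg] at h1
      nth_rw 1 [← h1]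
      group
    | zero => rw [map_zero, map_zero]
    | add x y _ _ hx hy => rw [map_add, map_add, hx, hy, add_zero]
    | smul r x _ hx => rw [map_smul, map_smul, hx, smul_zero]
  · refine eq_top_iff.2 ?_
    rintro z -
    induction z using glob_induction with
    | mk s y =>
      have key : (⊤ : Submodule K Y) ≤ (Submodule.span K {v | ∃ (s : G) (w : globPiece P g),
          v = globRep K G Y s ((globPiece P g).subtype w)}).comap (globMkₗ K Y s) := by
        rw [← hP]
        refine iSup_le fun t y hy => ?_
        by_cases ht : IsConj g t
        · obtain ⟨c, hc⟩ := isConj_iff.1 ht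
          -- With `t = c g c⁻¹`, the class `⌊c⁻¹, y⌋` has degree `g`, and `s c` carries it to `⌊s,
          -- y⌋`.
          refine Submodule.subset_span ⟨s * c, ⟨globMk K c⁻¹ y,
            Submodule.subset_span ⟨c⁻¹, t, y, by rw [← hc]; group, hy, rfl⟩⟩, ?_⟩
          rw [Submodule.subtype_apply, globRep_globMk, mul_inv_cancel_right, globMkₗ_apply]
        · rw [hconj t ht, Submodule.mem_bot] at hy
          rw [hy]
          exact zero_mem _
      exact key (x := y) trivial
    | add a b ha hb => exact add_mem ha hb

end GradedGlobalization

/-! ### Homogeneous projections on `X_ḡ` and the two isomorphisms -/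

namespace ConjGrading

variable {K G : Type u} [CommRing K] [Group G] {X : Type u} [AddCommGroup X] [Module K X]
  [Module (KPar K G) X] (𝒳 : ConjGrading K G X) (g : G)

open Classical in
/-- The projection of `X` onto `X_t`. -/
def proj (t : G) : X →ₗ[K] X :=
  (𝒳.piece t).subtype ∘ₗ DirectSum.component K G (fun t => 𝒳.piece t) t ∘ₗ
    (LinearEquiv.ofBijective (DirectSum.coeLinearMap 𝒳.piece) 𝒳.isInternal).symm.toLinearMap

theorem proj_mem (t : G) (x : X) : 𝒳.proj t x ∈ 𝒳.piece t := Subtype.property _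

open Classical in
theorem proj_of_mem (t t' : G) {x : X} (hx : x ∈ 𝒳.piece t') :
    𝒳.proj t x = if t = t' then x else 0 := by
  have h : (LinearEquiv.ofBijective (DirectSum.coeLinearMap 𝒳.piece) 𝒳.isInternal).symm x =
      DirectSum.lof K G (fun t => 𝒳.piece t) t' ⟨x, hx⟩ := by
    exact (LinearEquiv.symm_apply_eq _).2 (DirectSum.coeLinearMap_lof 𝒳.piece t' ⟨x, hx⟩).symm
  change ((DirectSum.component K G (fun t => 𝒳.piece t) t
    ((LinearEquiv.ofBijective (DirectSum.coeLinearMap 𝒳.piece) 𝒳.isInternal).symm x) :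
      𝒳.piece t) : X) = _
  rw [h, DirectSum.component.of]
  split_ifs with h1 h2 h2
  · subst h1; rfl
  · exact absurd h1.symm h2
  · exact absurd h2.symm h1
  · rfl

variable [IsScalarTower K (KPar K G) X]

theorem piece_le_conjComponent {t : G} (ht : IsConj g t) {x : X} (hx : x ∈ 𝒳.piece t) :
    x ∈ 𝒳.conjComponent g :=
  Submodule.mem_iSup_of_mem (p := fun t => ⨆ (_ : IsConj g t), 𝒳.piece t) t
    (Submodule.mem_iSup_of_mem ht hx)

theorem conjPiece_of_isConj {t : G} (ht : IsConj g t) {y : 𝒳.conjComponent g} :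
    y ∈ 𝒳.conjPiece g t ↔ (y : X) ∈ 𝒳.piece t := by
  rw [conjPiece, if_pos ht]
  rfl

theorem conjPiece_of_not_isConj {t : G} (ht : ¬ IsConj g t) : 𝒳.conjPiece g t = ⊥ :=
  if_neg ht

theorem coe_mem_piece {t : G} {y : 𝒳.conjComponent g} (hy : y ∈ 𝒳.conjPiece g t) :
    (y : X) ∈ 𝒳.piece t := by
  by_cases ht : IsConj g t
  · exact (𝒳.conjPiece_of_isConj g ht).1 hy
  · rw [𝒳.conjPiece_of_not_isConj g ht, Submodule.mem_bot] at hy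
    rw [hy]
    exact zero_mem _

theorem iSup_conjPiece : ⨆ t, 𝒳.conjPiece g t = ⊤ := by
  refine eq_top_iff.2 ?_
  rintro ⟨x, hx⟩ -
  have key : (⨆ (t : G) (_ : IsConj g t), 𝒳.piece t) ≤ (⨆ t, 𝒳.conjPiece g t).map
      ((𝒳.conjComponent g).subtype.restrictScalars K) :=
    iSup₂_le fun t ht y hy => ⟨⟨y, 𝒳.piece_le_conjComponent g ht hy⟩,
      Submodule.mem_iSup_of_mem t ((𝒳.conjPiece_of_isConj g ht).2 hy), rfl⟩
  obtain ⟨y, hy, rfl⟩ := key hx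
  exact hy

theorem proj_mem_conjComponent (t : G) {x : X} (hx : x ∈ 𝒳.conjComponent g) :
    𝒳.proj t x ∈ 𝒳.conjComponent g := by
  have key : (⨆ (t : G) (_ : IsConj g t), 𝒳.piece t) ≤
      (⨆ (t : G) (_ : IsConj g t), 𝒳.piece t).comap (𝒳.proj t) := by
    refine iSup₂_le fun t' ht y hy => ?_
    rw [Submodule.mem_comap, proj_of_mem 𝒳 t t' hy]
    split_ifs
    · exact 𝒳.piece_le_conjComponent g ht hy
    · exact zero_mem _
  exact key hx

/-- The projection of `X_ḡ` onto its component of degree `t`. -/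
def conjProj (t : G) : 𝒳.conjComponent g →ₗ[K] 𝒳.conjComponent g where
  toFun y := ⟨𝒳.proj t y, 𝒳.proj_mem_conjComponent g t y.2⟩
  map_add' x y := Subtype.ext (map_add (𝒳.proj t) (x : X) (y : X))
  map_smul' r x := Subtype.ext (map_smul (𝒳.proj t) r (x : X))

theorem br_smul_mem_conjPiece (h t : G) {y : 𝒳.conjComponent g} (hy : y ∈ 𝒳.conjPiece g t) :
    br K h • y ∈ 𝒳.conjPiece g (h * t * h⁻¹) := by
  by_cases ht : IsConj g t
  · exact (𝒳.conjPiece_of_isConj g (ht.trans (isConj_iff.2 ⟨h, rfl⟩))).2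
      (𝒳.br_smul_mem h t y (𝒳.coe_mem_piece g hy))
  · rw [𝒳.conjPiece_of_not_isConj g ht, Submodule.mem_bot] at hy
    rw [hy, smul_zero]
    exact zero_mem _

theorem parHomology_conjComponent (n : ℕ) :
    Nonempty (parHomology K G (𝒳.conjComponent g) n ≅
      groupHomology (Rep.of (globPieceRep (𝒳.conjPiece g) g)) n) := by
  obtain ⟨e⟩ := parHomology_iso_groupHomology (K := K) (G := G) (𝒳.conjComponent g) n
  obtain ⟨e'⟩ := groupHomology_globRep_iso_globPieceRep (𝒳.conjPiece g) (𝒳.iSup_conjPiece g)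
    (fun h t y hy => 𝒳.br_smul_mem_conjPiece g h t hy) (𝒳.conjProj g)
    (fun t y hy => Subtype.ext ((proj_of_mem 𝒳 t t (𝒳.coe_mem_piece g hy)).trans (if_pos rfl)))
    (fun t t' ht y hy =>
      Subtype.ext ((proj_of_mem 𝒳 t t' (𝒳.coe_mem_piece g hy)).trans (if_neg ht))) g
    (fun t ht y => (𝒳.conjPiece_of_isConj g ht).2 (𝒳.proj_mem t y))
    (fun t ht => 𝒳.conjPiece_of_not_isConj g ht) n
  exact ⟨e ≪≫ e'⟩

/-! ### The component of degree `g` as a module over the centralizer -/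

instance pieceScalarTower :
    IsScalarTower K (KPar K (Subgroup.centralizer {g})) (𝒳.piece g) where
  smul_assoc r z x := by
    change 𝒳.pieceAction g (r • z) x = r • 𝒳.pieceAction g z x
    rw [map_smul]
    rfl

/-- The inclusion of `X_g` in `X_ḡ`. -/
def pieceIncl : 𝒳.piece g →ₗ[K] 𝒳.conjComponent g where
  toFun x := ⟨x, 𝒳.piece_le_conjComponent g (IsConj.refl g) x.2⟩
  map_add' _ _ := rfl
  map_smul' _ _ := rfl

theorem pieceIncl_injective : Function.Injective (𝒳.pieceIncl g) := fun _ _ h =>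
  Subtype.ext (congrArg (Subtype.val : 𝒳.conjComponent g → X) h)

theorem pieceIncl_br_smul (c : Subgroup.centralizer {g}) (x : 𝒳.piece g) :
    𝒳.pieceIncl g (br K c • x) = br K (c : G) • 𝒳.pieceIncl g x :=
  Subtype.ext (𝒳.piece_br_smul g c x)

theorem pieceIncl_idem_smul (c : Subgroup.centralizer {g}) (x : 𝒳.piece g) :
    𝒳.pieceIncl g (idem K c • x) = idem K (c : G) • 𝒳.pieceIncl g x := by
  rw [idem, mul_smul, pieceIncl_br_smul, pieceIncl_br_smul, idem, mul_smul]
  rfl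

/-- The map from the globalization of `X_g` with respect to the centralizer of `g` to the
globalization of `X_ḡ`. -/
def globPieceIncl :
    Glob K (Subgroup.centralizer {g}) (𝒳.piece g) →ₗ[K] Glob K G (𝒳.conjComponent g) :=
  globLift (fun c => globMkₗ K _ (c : G) ∘ₗ 𝒳.pieceIncl g) fun c d x => by
    simp only [LinearMap.comp_apply, globMkₗ_apply]
    rw [pieceIncl_br_smul, globMk_br_smul, pieceIncl_idem_smul]
    rfl

theorem globPieceIncl_globMk (c : Subgroup.centralizer {g}) (x : 𝒳.piece g) :
    𝒳.globPieceIncl g (globMk K c x) = globMk K (c : G) (𝒳.pieceIncl g x) :=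
  globLift_globMk _ _ _ _

theorem globPieceIncl_globRep (c : Subgroup.centralizer {g})
    (z : Glob K (Subgroup.centralizer {g}) (𝒳.piece g)) :
    𝒳.globPieceIncl g (globRep K _ _ c z) = globRep K G _ (c : G) (𝒳.globPieceIncl g z) := by
  induction z using glob_induction with
  | mk d x =>
    rw [globRep_globMk, globPieceIncl_globMk, globPieceIncl_globMk, globRep_globMk]
    rfl
  | add a b ha hb => simp only [map_add, ha, hb]

theorem globRetract_globPieceIncl (z : Glob K (Subgroup.centralizer {g}) (𝒳.piece g)) :
    globRetract K G _ (𝒳.globPieceIncl g z) = 𝒳.pieceIncl g (globRetract K _ _ z) := by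
  induction z using glob_induction with
  | mk d x =>
    rw [globPieceIncl_globMk, globRetract_globMk, globRetract_globMk, pieceIncl_br_smul]
  | add a b ha hb => simp only [map_add, ha, hb]

/-- Zero in the smaller globalization is detected by the retractions of translates by `c` in the
centralizer, and these are compatible with the retraction of `Λ(X_ḡ)`. -/
theorem globPieceIncl_injective : Function.Injective (𝒳.globPieceIncl g) := by
  refine (injective_iff_map_eq_zero _).2 fun z hz => glob_eq_zero fun c =>
    𝒳.pieceIncl_injective g ?_
  rw [← globRetract_globPieceIncl, globPieceIncl_globRep, hz, map_zero, map_zero, map_zero]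

theorem globPieceIncl_mem (z : Glob K (Subgroup.centralizer {g}) (𝒳.piece g)) :
    𝒳.globPieceIncl g z ∈ globPiece (𝒳.conjPiece g) g := by
  induction z using glob_induction with
  | mk d x =>
    rw [globPieceIncl_globMk]
    exact Submodule.subset_span ⟨d, g, _, centralizer_conj d,
      (𝒳.conjPiece_of_isConj g (IsConj.refl g)).2 x.2, rfl⟩
  | add a b ha hb => rw [map_add]; exact add_mem ha hb

/-- The spanning hypothesis reduces to `y = [k] x` with `x ∈ X_g` and `k g k⁻¹ = t`. Then `⌊h, [k]
x⌋ = ⌊h k, e_{k⁻¹} x⌋`, where `h k` centralizes `g` and `e_{k⁻¹} x` stays in `X_g`. -/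
theorem globPiece_le_range (hX : ∀ t : G, IsConj g t →
    𝒳.piece t = ⨆ (h : G) (_ : h * g * h⁻¹ = t), (𝒳.piece g).map (brMap K X h)) :
    globPiece (𝒳.conjPiece g) g ≤ LinearMap.range (𝒳.globPieceIncl g) := by
  refine Submodule.span_le.2 ?_
  rintro _ ⟨h, t, y, hg, hy, rfl⟩
  have ht : IsConj g t := isConj_iff.2 ⟨h⁻¹, by rw [← hg]; group⟩
  -- The claim is pushed forward to `X`, where the hypothesis lives, and pulled back at the end by
  -- injectivity of the inclusion of `X_ḡ`.
  have key : 𝒳.piece t ≤ ((LinearMap.range (𝒳.globPieceIncl g)).comap (globMkₗ K _ h)).map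
      ((𝒳.conjComponent g).subtype.restrictScalars K) := by
    rw [hX t ht]
    refine iSup₂_le fun k hk => ?_
    rintro _ ⟨x, hx, rfl⟩
    have hc : h * k ∈ Subgroup.centralizer {g} := by
      refine Subgroup.mem_centralizer_singleton_iff.2 ?_
      rw [← hk] at hg
      nth_rw 2 [← hg]
      group
    have hx' : idem K k⁻¹ • x ∈ 𝒳.piece g := by
      have := 𝒳.br_smul_mem k⁻¹ _ _ (𝒳.br_smul_mem k g x hx)
      have h1 : k⁻¹ * (k * g * k⁻¹) * k⁻¹⁻¹ = g := by group
      rw [h1, smul_smul] at this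
      rwa [idem, inv_inv]
    refine ⟨br K k • 𝒳.pieceIncl g ⟨x, hx⟩,
      ⟨globMk K ⟨h * k, hc⟩ ⟨idem K k⁻¹ • x, hx'⟩, ?_⟩, rfl⟩
    rw [globPieceIncl_globMk, globMkₗ_apply, globMk_br_smul]
    rfl
  obtain ⟨y', hy', hyy⟩ := key (𝒳.coe_mem_piece g hy)
  obtain rfl : y' = y := Subtype.ext hyy
  exact hy'

theorem parHomology_conjComponent_of_span (hX : ∀ t : G, IsConj g t →
    𝒳.piece t = ⨆ (h : G) (_ : h * g * h⁻¹ = t), (𝒳.piece g).map (brMap K X h)) (n : ℕ) :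
    Nonempty (parHomology K G (𝒳.conjComponent g) n ≅
      parHomology K (Subgroup.centralizer {g}) (𝒳.piece g) n) := by
  obtain ⟨e⟩ := 𝒳.parHomology_conjComponent g n
  obtain ⟨e'⟩ := parHomology_iso_groupHomology (K := K) (G := Subgroup.centralizer {g})
    (𝒳.piece g) n
  let Φ : Rep.of (globRep K (Subgroup.centralizer {g}) (𝒳.piece g)) ⟶
      Rep.of (globPieceRep (𝒳.conjPiece g) g) :=
    Rep.ofHom ⟨(𝒳.globPieceIncl g).codRestrict _ (𝒳.globPieceIncl_mem g), fun c =>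
      LinearMap.ext fun z => Subtype.ext (𝒳.globPieceIncl_globRep g c z)⟩
  have : Mono Φ := (Rep.mono_iff_injective Φ).2 fun a b hab =>
    𝒳.globPieceIncl_injective g (congrArg Subtype.val hab)
  have : Epi Φ := (Rep.epi_iff_surjective Φ).2 fun z => by
    obtain ⟨y, hy⟩ := 𝒳.globPiece_le_range g hX z.2
    exact ⟨y, Subtype.ext hy⟩
  have : IsIso Φ := isIso_of_mono_of_epi Φ
  exact ⟨e ≪≫ (groupHomology.functor K _ n).mapIso (asIso Φ).symm ≪≫ e'.symm⟩

end ConjGrading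

end PartialHomology

end

theorem mainTheorem5 {K G : Type u} [CommRing K] [Group G] {X : Type u} [AddCommGroup X]
    [Module K X] [Module (PartialHomology.KPar K G) X]
    [IsScalarTower K (PartialHomology.KPar K G) X]
    (𝒳 : PartialHomology.ConjGrading K G X) (g : G) :
    (∀ n : ℕ, Nonempty
      (PartialHomology.parHomology K G (𝒳.conjComponent g) n ≅
        groupHomology (Rep.of (PartialHomology.globPieceRep (𝒳.conjPiece g) g)) n)) ∧
    ((∀ t : G, IsConj g t →
        𝒳.piece t = ⨆ (h : G) (_ : h * g * h⁻¹ = t),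
          (𝒳.piece g).map (PartialHomology.brMap K X h)) →
      ∀ n : ℕ, Nonempty
        (PartialHomology.parHomology K G (𝒳.conjComponent g) n ≅
          PartialHomology.parHomology K (Subgroup.centralizer {g}) (𝒳.piece g) n)) :=
  ⟨𝒳.parHomology_conjComponent g, 𝒳.parHomology_conjComponent_of_span g⟩
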